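/- All fields are subfields of a fixed algebraically closed field $\Omega$ of prime characteristic $p>0$. For a subfield $F$ put $F^{p^n}=\{x^{p^n}: x\in F\}$ and $F^{p^{-n}}=\{x\in\Omega: x^{p^n}\in F\}$. Definitions, for fields $F\subseteq E$ with $E/F$ purely inseparable. An $r$-base of $E/F$ is a set $B\subseteq E$ with $E=F(E^p)(B)$ and $x\notin F(E^p)(B\setminus\{x\})$ for all $x\in B$; all $r$-bases have the same cardinality. The degree of irrationality $di(E/F)$ is the supremum over $n\ge 1$ of the cardinalities of the $r$-bases of $(F^{p^{-n}}\cap E)/F$, and the degree of imperfection of $F$ is $di(F/F^p)$. A family in $F$ is $p$-free if no member lies in the field generated over $F^p$ by the other members. For $a\in E$, $o(a,F)$ is the least $m$ with $a^{p^m}\in F$; the exponent of $E/F$ is the least $m$ with $E^{p^m}\subseteq F$, if there is one, and otherwise $E/F$ is of unbounded exponent. $E/F$ is modular if $E^{p^n}$ and $F$ are linearly disjoint over $E^{p^n}\cap F$ for all $n$. $E/F$ is equiexponential of exponent $e$ if it has exponent $e$ and an $r$-base $G$ with $o(a,F(G\setminus\{a\}))=o(a,F)=e$ for all $a\in G$.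 For $j\geq 1$, $E/F$ is $j$-$w_0$-generated if there is no field $S$ with $F\subseteq S\subsetneq E$ such that $S/F$ is of unbounded exponent and $di(S/F)\le j$; it is $+\infty$-$w_0$-generated if it is $j$-$w_0$-generated for every $j\ge1$. **Theorem.** Let $k$ be a countable field of characteristic $p$ with infinite degree of imperfection, and let $\Omega$ be an algebraic closure of $k$. Then there are families $((X_i)_{i\in\mathbb N},t)$ in $k$ that are $p$-free. Let $((X_i)_{i\in\mathbb N},t)$ be any such family, and put $M_1=k\big((X_i^{p^{-1}})_{i}\big)$ and $M_2=k\big((X_i^{p^{-2}})_{i}\big)$. Then the set $E$ of all fields $L$ with $k\subsetneq L\subsetneq M_1$ and $L/k$ finite can be enumerated as $E=\{L_n : n\ge 3\}$. For every such enumeration $(L_n)_{n\ge3}$: 1. there is a sequence of fields $M_1\subseteq M_2\subseteq M_3\subseteq\cdots$ in $\Omega$, starting with the above $M_1$ and $M_2$, such that $k^{p^{-n}}\cap M_{n+1}=M_n$ for all $n\ge1$, and such that for all $n\ge 3$ the extension $M_n/k$ is equiexponential of exponent $n$ and $M_n/L_n$ is not modular; 2. for every such sequence $(M_n)_{n\geq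 1}$, the set $K=\bigcup_{n\ge1}M_n$ is a field, and $K/k$ is modular, $+\infty$-$w_0$-generated, and of infinite degree of irrationality. -/

import Mathlib

/-!
Purely inseparable extensions inside a fixed field `Ω` of characteristic `p`.  All fields are subfields of `Ω`;
an extension `E/F` is a pair of subfields `F ≤ E`.
-/

noncomputable section

namespace PurelyInsep

variable {Ω : Type*} [Field Ω]

/-- `F(S)`: the subfield of `Ω` generated by `F` and the set `S`. -/
def adj (F : Subfield Ω) (S : Set Ω) : Subfield Ω :=
  (IntermediateField.adjoin F S).toSubfield

/-- The subfield `E ^ (p ^ n)` of the `p ^ n`-th powers of elements of `E`. -/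
def powField (p : ℕ) [ExpChar Ω p] (n : ℕ) (E : Subfield Ω) : Subfield Ω :=
  E.map (iterateFrobenius Ω p n)

/-- The subfield `F ^ (p ^ (-n))` of all `x` in `Ω` with `x ^ (p ^ n) ∈ F`. -/
def rootField (p : ℕ) [ExpChar Ω p] (n : ℕ) (F : Subfield Ω) : Subfield Ω :=
  F.comap (iterateFrobenius Ω p n)

/-- `E/F` is a finite extension. -/
def IsFiniteExt (F E : Subfield Ω) : Prop :=
  ∃ h : F ≤ E, FiniteDimensional F (Subfield.extendScalars h)

/-- `E/F` is a purely inseparable extension. -/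
def IsPurelyInsep (F E : Subfield Ω) : Prop :=
  ∃ h : F ≤ E, IsPurelyInseparable F (Subfield.extendScalars h)

/-- `A` and `B` are linearly disjoint over `A ⊓ B`. -/
def LinDisj (A B : Subfield Ω) : Prop :=
  (Subfield.extendScalars (inf_le_left : A ⊓ B ≤ A)).LinearDisjoint
    (Subfield.extendScalars (inf_le_right : A ⊓ B ≤ B))

/-- `E/F` is modular: it is purely inseparable and, for all `n`, the fields `E ^ (p ^ n)` and `F` are linearly
disjoint over their intersection. -/
def IsModular (p : ℕ) [ExpChar Ω p] (F E : Subfield Ω) : Prop :=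
  IsPurelyInsep F E ∧ ∀ n : ℕ, LinDisj (powField p n E) F

/-- `B` is an `r`-base of `E/F`: a minimal generating set of `E` over `F(E ^ p)`. -/
def IsRBase (p : ℕ) [ExpChar Ω p] (F E : Subfield Ω) (B : Set Ω) : Prop :=
  B ⊆ E ∧ adj F (powField p 1 E ∪ B) = E ∧ ∀ x ∈ B, x ∉ adj F (powField p 1 E ∪ (B \ {x}))

/-- The cardinality of an `r`-base of `E/F` (all `r`-bases of `E/F` have the same cardinality). -/
def rBaseCard (p : ℕ) [ExpChar Ω p] (F E : Subfield Ω) : Cardinal :=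
  sInf {c | ∃ B : Set Ω, IsRBase p F E B ∧ Cardinal.mk B = c}

/-- The degree of irrationality `di(E/F)`: the supremum over `n ≥ 1` of the cardinalities of the `r`-bases of
`(F ^ (p ^ (-n)) ∩ E)/F`. -/
def irrDegree (p : ℕ) [ExpChar Ω p] (F E : Subfield Ω) : Cardinal :=
  ⨆ n : ℕ, rBaseCard p F (rootField p (n + 1) F ⊓ E)

/-- The degree of imperfection of `F`, that is `di(F/F ^ p)`. -/
def imperfectionDegree (p : ℕ) [ExpChar Ω p] (F : Subfield Ω) : Cardinal :=
  irrDegree p (powField p 1 F) F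

/-- The family `Y` of elements of `F` is `p`-independent (`p`-free): no member lies in the field generated over
`F ^ p` by the others. -/
def IsPFree (p : ℕ) [ExpChar Ω p] (F : Subfield Ω) {ι : Type*} (Y : ι → Ω) : Prop :=
  (∀ i, Y i ∈ F) ∧ ∀ i, Y i ∉ adj (powField p 1 F) (Y '' {i}ᶜ)

/-- `o(a, F)`: the least `m` with `a ^ (p ^ m) ∈ F`. -/
def elemExponent (p : ℕ) (F : Subfield Ω) (a : Ω) : ℕ :=
  sInf {m | a ^ p ^ m ∈ F}

/-- `E/F` has exponent `e`: the number `e` is the least `m` with `E ^ (p ^ m) ⊆ F`. -/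
def HasExponentEq (p : ℕ) (F E : Subfield Ω) (e : ℕ) : Prop :=
  IsLeast {m : ℕ | ∀ x ∈ E, x ^ p ^ m ∈ F} e

/-- `E/F` is of bounded exponent. -/
def HasBoundedExponent (p : ℕ) (F E : Subfield Ω) : Prop :=
  ∃ m : ℕ, ∀ x ∈ E, x ^ p ^ m ∈ F

/-- `E/F` is equiexponential of exponent `e`: it is purely inseparable of exponent `e` and has an `r`-base `G` such
that `o(a, F(G \ {a})) = o(a, F) = e` for every `a ∈ G`. -/
def IsEquiexponential (p : ℕ) [ExpChar Ω p] (F E : Subfield Ω) (e : ℕ) : Prop :=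
  IsPurelyInsep F E ∧ HasExponentEq p F E e ∧
    ∃ G : Set Ω, IsRBase p F E G ∧
      ∀ a ∈ G, elemExponent p (adj F (G \ {a})) a = e ∧ elemExponent p F a = e

/-- `E/F` is `j`-`w₀`-generated: it is purely inseparable and has no proper subextension of unbounded exponent whose
degree of irrationality is at most `j`. -/
def IsJW0Generated (p : ℕ) [ExpChar Ω p] (F E : Subfield Ω) (j : ℕ) : Prop :=
  IsPurelyInsep F E ∧
    ¬ ∃ S : Subfield Ω, F ≤ S ∧ S < E ∧ ¬ HasBoundedExponent p F S ∧ irrDegree p F S ≤ j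

/-- `E/F` is `+∞`-`w₀`-generated: it is `j`-`w₀`-generated for all `j ≥ 1`. -/
def IsInftyW0Generated (p : ℕ) [ExpChar Ω p] (F E : Subfield Ω) : Prop :=
  ∀ j : ℕ, 1 ≤ j → IsJW0Generated p F E j

/-- The field generated over `k` by the `p ^ n`-th roots of the `X i`. -/
def adjRoots (p : ℕ) (k : Subfield Ω) (X : ℕ → Ω) (n : ℕ) : Subfield Ω :=
  adj k {y | ∃ i, y ^ p ^ n = X i}

/-- The set of the finite proper subextensions of `M₁/k` (different from `k` and from `M₁`), where
`M₁` is generated over `k` by the `p`-th roots of the `X i`. -/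
def properFiniteSubexts (p : ℕ) (k : Subfield Ω) (X : ℕ → Ω) : Set (Subfield Ω) :=
  {L | k < L ∧ L < adjRoots p k X 1 ∧ IsFiniteExt k L}

/-- `(M n)`, `n ≥ 1`, is a tower built from the family `X` and the sequence `(L n)`, `n ≥ 3`.
(The value `M 0` plays no role.) -/
structure IsTower (p : ℕ) [ExpChar Ω p] (k : Subfield Ω) (X : ℕ → Ω) (L M : ℕ → Subfield Ω) : Prop where
  one : M 1 = adjRoots p k X 1
  two : M 2 = adjRoots p k X 2
  mono : ∀ n, 1 ≤ n → M n ≤ M (n + 1)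
  inf_succ : ∀ n, 1 ≤ n → rootField p n k ⊓ M (n + 1) = M n
  equi : ∀ n, 3 ≤ n → IsEquiexponential p k (M n) n
  not_modular : ∀ n, 3 ≤ n → ¬ IsModular p (L n) (M n)

end PurelyInsep

end

noncomputable section

namespace PurelyInsep

open Polynomial

/-! ### Adjunction, and polynomial expressions in one generator -/

section Adj

variable {Ω : Type*} [Field Ω]

/-! For a `p`-independent family `c` in `k`, let `rootExt n c` be the field generated over `k` by
the `p ^ n`-th roots of `c`; it corresponds to `k^{p^n}(c)` under the `n`-th Frobenius power. It is
therefore unchanged when each `c i`, `i < s`, is replaced by `c i + t^{p^n} * c (i + s)`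
(`rootExt_twist`). One level higher the twist matters, since `t^{p^n}` is not in `k^{p^{n+1}}(c)`.
The tower takes `M n = rootExt n c` with `c` twisted once more at each step, so lower levels survive
and each `M n` is equiexponential.

The twist destroys modularity over the prescribed finite `L`. Choose `s` so that `L` lies in the
field generated by the `p`-th roots of the `c i`, `i < s`, and let `P` be the field of `p^n`-th
powers of `M (n + 1)`. Then `L` lies in `k(P)`, while `P ∩ L` lies in `k` by
`PIndep.mem_of_mem_adj_twist`. Linear disjointness of `P` and `L` would force `L = k`
(`le_of_linDisj`).

For the union `K` of any such tower, modularity passes up from the `M n`, because equiexponential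
extensions are modular. A subextension `S` of finite degree of irrationality has finite first layer
`k^{1/p} ∩ S`. If `S` has unbounded exponent, the fields `k((k^{p^{-(n+1)}} ∩ S)^{p^n})` decrease
inside this layer to some `V ≠ k`, finite over `k`, hence some `L n`. But stationarity makes `V`
generated over `k` by `p^r`-th powers of elements of `M n`, for all `r < n`, so `M n / V` is modular
(`LinDisj.of_adj`), a contradiction. The degree of irrationality of `K` is infinite because already
`M 1` is infinite over `k`. -/

theorem adj_eq_closure (F : Subfield Ω) (S : Set Ω) : adj F S = Subfield.closure (F ∪ S) := by
  rw [adj, IntermediateField.adjoin_toSubfield]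
  congr 2
  ext x
  simp [Algebra.algebraMap_eq_smul_one, Subfield.smul_def]

theorem le_adj (F : Subfield Ω) (S : Set Ω) : F ≤ adj F S := by
  rw [adj_eq_closure]
  exact fun x hx => Subfield.subset_closure (Or.inl hx)

theorem subset_adj (F : Subfield Ω) (S : Set Ω) : S ⊆ adj F S := by
  rw [adj_eq_closure]
  exact fun x hx => Subfield.subset_closure (Or.inr hx)

theorem adj_le_iff {F E : Subfield Ω} {S : Set Ω} : adj F S ≤ E ↔ F ≤ E ∧ S ⊆ E := by
  rw [adj_eq_closure, Subfield.closure_le, Set.union_subset_iff]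
  rfl

theorem adj_le {F E : Subfield Ω} {S : Set Ω} (h : F ≤ E) (h' : S ⊆ E) : adj F S ≤ E :=
  adj_le_iff.2 ⟨h, h'⟩

theorem adj_mono {F E : Subfield Ω} {S T : Set Ω} (h : F ≤ E) (h' : S ⊆ T) : adj F S ≤ adj E T :=
  adj_le (h.trans (le_adj _ _)) (h'.trans (subset_adj _ _))

theorem adj_eq_self {F : Subfield Ω} {S : Set Ω} (h : S ⊆ F) : adj F S = F :=
  le_antisymm (adj_le le_rfl h) (le_adj _ _)

theorem adj_union (F : Subfield Ω) (S T : Set Ω) : adj F (S ∪ T) = adj (adj F S) T :=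
  le_antisymm
    (adj_le ((le_adj _ _).trans (le_adj _ _))
      (Set.union_subset ((subset_adj _ _).trans (le_adj _ _)) (subset_adj _ _)))
    (adj_le (adj_mono le_rfl Set.subset_union_left)
      (Set.subset_union_right.trans (subset_adj _ _)))

theorem map_adj (φ : Ω →+* Ω) (F : Subfield Ω) (S : Set Ω) :
    (adj F S).map φ = adj (F.map φ) (φ '' S) := by
  rw [adj_eq_closure, adj_eq_closure, RingHom.map_field_closure, Set.image_union]
  rfl

theorem exists_finset_of_mem_adj {F : Subfield Ω} {S : Set Ω} {x : Ω} (hx : x ∈ adj F S) :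
    ∃ T : Finset Ω, (T : Set Ω) ⊆ S ∧ x ∈ adj F (T : Set Ω) :=
  IntermediateField.exists_finset_of_mem_adjoin hx

theorem exists_finset_of_mem_adj_image {ι : Type*} {F : Subfield Ω} {c : ι → Ω} {J : Set ι} {x : Ω}
    (hx : x ∈ adj F (c '' J)) :
    ∃ T : Finset ι, (T : Set ι) ⊆ J ∧ x ∈ adj F (c '' (T : Set ι)) := by
  classical
  obtain ⟨T, hT, hxT⟩ := exists_finset_of_mem_adj hx
  obtain ⟨T', hT', rfl⟩ := Finset.subset_set_image_iff.1 hT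
  exact ⟨T', hT', by simpa using hxT⟩

theorem coeff_mem_algebraMap {A : Subfield Ω} (f : A[X]) (i : ℕ) :
    (f.map (algebraMap A Ω)).coeff i ∈ A := by
  rw [coeff_map]
  exact (f.coeff i).2

theorem exists_map_eq {A : Subfield Ω} {f : Polynomial Ω} (hf : ∀ i, f.coeff i ∈ A) :
    ∃ g : A[X], g.map (algebraMap A Ω) = f := by
  have : f ∈ lifts (algebraMap A Ω) := by
    rw [lifts_iff_coeff_lifts]
    exact fun i => ⟨⟨f.coeff i, hf i⟩, rfl⟩
  exact (mem_lifts f).1 this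

theorem eval_mem {A : Subfield Ω} {f : Polynomial Ω} (hf : ∀ i, f.coeff i ∈ A) {x : Ω} (hx : x ∈ A) :
    f.eval x ∈ A := by
  rw [eval_eq_sum_range]
  exact sum_mem fun i _ => mul_mem (hf i) (pow_mem hx i)

/-- If `g ^ q ∈ A` then every element of `A(g)` is a polynomial in `g` of degree less than `q`. -/
theorem exists_eval_eq_of_mem_adj {A : Subfield Ω} {g : Ω} {q : ℕ} (hq : 0 < q) (hg : g ^ q ∈ A)
    {y : Ω} (hy : y ∈ adj A {g}) :
    ∃ f : Polynomial Ω, (∀ i, f.coeff i ∈ A) ∧ f.natDegree < q ∧ f.eval g = y := by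
  set m : A[X] := X ^ q - C ⟨g ^ q, hg⟩ with hm
  have hmon : m.Monic := monic_X_pow_sub_C _ hq.ne'
  have hmg : aeval g m = 0 := by simp [hm, Algebra.algebraMap_eq_smul_one, Subfield.smul_def]
  have hint : IsIntegral A g := ⟨m, hmon, hmg⟩
  have hy' : y ∈ (IntermediateField.adjoin A {g}).toSubalgebra := hy
  rw [IntermediateField.adjoin_simple_toSubalgebra_of_isAlgebraic hint.isAlgebraic] at hy'
  obtain ⟨f, rfl⟩ := (Algebra.adjoin_singleton_eq_range_aeval A g ▸ hy' :)
  refine ⟨(f %ₘ m).map (algebraMap A Ω), coeff_mem_algebraMap _, ?_, ?_⟩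
  · rw [natDegree_map]
    have := natDegree_modByMonic_lt f hmon (by
      intro h
      have := congrArg natDegree h
      rw [hm, natDegree_X_pow_sub_C] at this
      simp at this
      omega)
    rwa [hm, natDegree_X_pow_sub_C, ← hm] at this
  · rw [eval_map_algebraMap]
    change _ = aeval g f
    conv_rhs => rw [← modByMonic_add_div f m]
    simp [hmg]

end Adj

/-! ### Elements of `p`-power degree: uniqueness of coefficients and exchange -/

section Roots

variable {Ω : Type*} [Field Ω] (p : ℕ) [Fact p.Prime] [CharP Ω p]

theorem mem_powField {n : ℕ} {E : Subfield Ω} {x : Ω} :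
    x ∈ powField p n E ↔ ∃ y ∈ E, y ^ p ^ n = x := by
  simp [powField, Subfield.mem_map, iterateFrobenius_def]

theorem mem_rootField {n : ℕ} {E : Subfield Ω} {x : Ω} :
    x ∈ rootField p n E ↔ x ^ p ^ n ∈ E := by
  simp [rootField, Subfield.mem_comap, iterateFrobenius_def]

/-- If `h ^ p ^ e ∉ C`, then the powers of `h` of exponent less than `p ^ (e + 1)` are linearly
independent over `C`. -/
theorem eq_zero_of_eval_eq_zero {C : Subfield Ω} {h : Ω} {e : ℕ} (hh : h ^ p ^ e ∉ C)
    (hh' : h ^ p ^ (e + 1) ∈ C) {f : Polynomial Ω} (hf : ∀ i, f.coeff i ∈ C)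
    (hdeg : f.natDegree < p ^ (e + 1)) (h0 : f.eval h = 0) : f = 0 := by
  obtain ⟨f, rfl⟩ := exists_map_eq hf
  rw [eval_map_algebraMap] at h0
  rw [natDegree_map] at hdeg
  by_contra hne
  have hf0 : f ≠ 0 := by rintro rfl; simp at hne
  have : ExpChar C p := RingHom.expChar (algebraMap C Ω) (algebraMap C Ω).injective p
  -- The minimal polynomial of `h` is some `X ^ p ^ n - y`; a nonzero `f` of degree below `p ^ (e +
  -- 1)` forces `n ≤ e`, against `hh`.
  have h1 : (minpoly C h).natSepDegree = 1 :=
    (minpoly.natSepDegree_eq_one_iff_pow_mem p).2 ⟨e + 1, ⟨⟨_, hh'⟩, rfl⟩⟩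
  obtain ⟨n, y, hn⟩ := (minpoly.natSepDegree_eq_one_iff_eq_X_pow_sub_C p).1 h1
  have hle := natDegree_le_of_dvd (minpoly.dvd C h h0) hf0
  rw [hn, natDegree_X_pow_sub_C] at hle
  have hlt : n < e + 1 := (Nat.pow_lt_pow_iff_right (Fact.out : p.Prime).one_lt).1 (hle.trans_lt hdeg)
  have hy : h ^ p ^ n = algebraMap C Ω y := by
    have := minpoly.aeval C h
    rw [hn] at this
    simpa [sub_eq_zero] using this
  apply hh
  obtain ⟨d, rfl⟩ := Nat.exists_eq_add_of_le (Nat.lt_succ_iff.1 hlt)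
  rw [pow_add, pow_mul, hy]
  exact pow_mem y.2 _

theorem eq_zero_of_eval_eq_zero_of_notMem {C : Subfield Ω} {h : Ω} (hh : h ∉ C)
    (hh' : h ^ p ∈ C) {f : Polynomial Ω} (hf : ∀ i, f.coeff i ∈ C)
    (hdeg : f.natDegree < p) (h0 : f.eval h = 0) : f = 0 :=
  eq_zero_of_eval_eq_zero p (e := 0) (by simpa using hh) (by simpa using hh') hf (by simpa using hdeg) h0

/-- Uniqueness of the coefficients of polynomials in an element `g` of degree `p`. -/
theorem coeff_mem_of_eval_mem {A B : Subfield Ω} (hAB : A ≤ B) {g : Ω} (hg : g ^ p ∈ A) (hgB : g ∉ B)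
    {f : Polynomial Ω} (hf : ∀ i, f.coeff i ∈ B) (hdeg : f.natDegree < p) (hfg : f.eval g ∈ adj A {g}) (i : ℕ) :
    f.coeff i ∈ A := by
  obtain ⟨f', hf', hdeg', he⟩ := exists_eval_eq_of_mem_adj (Fact.out : p.Prime).pos hg hfg
  have : f - f' = 0 := by
    refine eq_zero_of_eval_eq_zero_of_notMem p hgB (hAB hg) (f := f - f') ?_ ?_ ?_
    · intro i
      rw [coeff_sub]
      exact sub_mem (hf i) (hAB (hf' i))
    · exact (natDegree_sub_le _ _).trans_lt (max_lt hdeg hdeg')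
    · simp [he]
  rw [sub_eq_zero.1 this]
  exact hf' i

/-- An element of `B` is a constant polynomial in `g` over `B`; uniqueness of coefficients puts this
constant in `A`. -/
theorem adj_singleton_inf_le {A B : Subfield Ω} (hAB : A ≤ B) {g : Ω} (hg : g ^ p ∈ A) (hgB : g ∉ B) :
    adj A {g} ⊓ B ≤ A := by
  rintro y ⟨hy, hyB⟩
  have := coeff_mem_of_eval_mem p hAB hg hgB (f := C y) (fun i => by
    rw [coeff_C]; split_ifs; exacts [hyB, zero_mem _]) (by simpa using (Fact.out : p.Prime).pos)
    (by simpa using hy) 0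
  simpa using this

/-- The exchange property. -/
theorem mem_adj_singleton_exchange {D : Subfield Ω} {a b : Ω} (ha : a ^ p ∈ D) (hb : b ∈ adj D {a})
    (hbD : b ∉ D) : a ∈ adj D {b} := by
  by_contra h
  exact hbD (adj_singleton_inf_le p (le_adj D {b}) ha h ⟨hb, subset_adj _ _ rfl⟩)

end Roots

/-! ### `p`-independent families and powers of the base field -/

section PIndep

variable {Ω : Type*} [Field Ω]

/-- The family `c` is `p`-independent over `Q`: the `p`-th powers of its members lie in `Q`, and no
member lies in the field generated over `Q` by the others. -/
def PIndep (p : ℕ) (Q : Subfield Ω) {ι : Type*} (c : ι → Ω) : Prop :=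
  ∀ i, c i ^ p ∈ Q ∧ c i ∉ adj Q (c '' {i}ᶜ)

variable {p : ℕ} {ι : Type*} {Q : Subfield Ω} {c : ι → Ω}

theorem PIndep.notMem (h : PIndep p Q c) {i : ι} {J : Set ι} (hi : i ∉ J) : c i ∉ adj Q (c '' J) :=
  fun hc => (h i).2 (adj_mono le_rfl (Set.image_mono fun j hj => by
    rintro rfl
    exact hi hj) hc)

theorem PIndep.comp (h : PIndep p Q c) {κ : Type*} {f : κ → ι} (hf : f.Injective) :
    PIndep p Q (c ∘ f) := fun i => ⟨(h _).1, fun hc => by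
  rw [Set.image_comp] at hc
  refine h.notMem (i := f i) (J := f '' {i}ᶜ) ?_ hc
  rintro ⟨j, hj, hij⟩
  exact hj (hf hij)⟩

theorem adj_image_insert (F : Subfield Ω) (c : ι → Ω) (J : Set ι) (i : ι) :
    adj F (c '' insert i J) = adj (adj F (c '' J)) {c i} := by
  rw [Set.image_insert_eq, ← Set.union_singleton, adj_union]

variable (p) [Fact p.Prime] [CharP Ω p]

/-- Only finitely many `c i` occur in a given element, and `adj_singleton_inf_le` removes them one
at a time. -/
theorem PIndep.adj_image_inf_le (h : PIndep p Q c) {R : Subfield Ω} (hRQ : R ≤ Q) {J : Set ι}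
    (hR : ∀ i ∈ J, c i ^ p ∈ R) : adj R (c '' J) ⊓ Q ≤ R := by
  classical
  rintro y ⟨hy, hyQ⟩
  obtain ⟨T, hTJ, hyT⟩ := exists_finset_of_mem_adj_image hy
  clear hy
  induction T using Finset.induction_on with
  | empty => simpa [adj_eq_self] using hyT
  | insert i T hi ih =>
    refine ih (fun j hj => hTJ (by simp at hj ⊢; tauto)) ?_
    rw [Finset.coe_insert, adj_image_insert] at hyT
    refine adj_singleton_inf_le p (adj_mono hRQ subset_rfl)
      (le_adj _ _ (hR i (hTJ (by simp)))) (h.notMem (by simpa using hi)) ⟨hyT, le_adj _ _ hyQ⟩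

theorem powField_succ_le (n : ℕ) (k : Subfield Ω) : powField p (n + 1) k ≤ powField p n k := by
  intro x hx
  obtain ⟨y, hy, rfl⟩ := (mem_powField p).1 hx
  exact (mem_powField p).2 ⟨y ^ p, pow_mem hy _, by rw [← pow_mul, pow_succ']⟩

theorem powField_le_one (n : ℕ) (k : Subfield Ω) : powField p (n + 1) k ≤ powField p 1 k := by
  induction n with
  | zero => exact le_rfl
  | succ n ih => exact (powField_succ_le p _ k).trans ih

theorem powField_le (n : ℕ) (k : Subfield Ω) : powField p n k ≤ k := by
  intro x hx
  obtain ⟨y, hy, rfl⟩ := (mem_powField p).1 hx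
  exact pow_mem hy _

theorem map_frobenius_powField (n : ℕ) (k : Subfield Ω) :
    (powField p n k).map (frobenius Ω p) = powField p (n + 1) k := by
  ext x
  simp only [Subfield.mem_map, mem_powField, frobenius_def]
  constructor
  · rintro ⟨_, ⟨y, hy, rfl⟩, rfl⟩
    exact ⟨y, hy, by rw [pow_succ, pow_mul]⟩
  · rintro ⟨y, hy, rfl⟩
    exact ⟨_, ⟨y, hy, rfl⟩, by rw [pow_succ, pow_mul]⟩

variable {k : Subfield Ω}

theorem frobenius_injective' : Function.Injective (frobenius Ω p) := (frobenius Ω p).injective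

/-- `k ^ p ∩ k ^ {p ^ (n + 1)} (c) = (k ^ {p ^ n} (c)) ^ p` -/
theorem PIndep.mem_adj_of_pow_mem (h : PIndep p (powField p 1 k) c) {J : Set ι} {n : ℕ} {x : Ω}
    (hc : ∀ i ∈ J, c i ∈ k) (hx : x ∈ k) (hxp : x ^ p ∈ adj (powField p (n + 1) k) (c '' J)) :
    x ∈ adj (powField p n k) (c '' J) := by
  have key : (adj (powField p n k) (c '' J)).map (frobenius Ω p) =
      adj (powField p (n + 1) k) (frobenius Ω p '' (c '' J)) := by
    rw [map_adj, map_frobenius_powField]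
  have hpow : ∀ y ∈ k, y ^ p ∈ powField p 1 k := fun y hy => (mem_powField p).2 ⟨y, hy, by simp⟩
  have : x ^ p ∈ (adj (powField p n k) (c '' J)).map (frobenius Ω p) := by
    -- The small field is `(k^{p^n}(c))^p = k^{p^{n+1}}(c^p)`: it lies in `k^p` and contains the `c
    -- i ^ p`, as required.
    refine h.adj_image_inf_le p (R := (adj (powField p n k) (c '' J)).map (frobenius Ω p)) (J := J)
      ?_ ?_ ⟨adj_mono ?_ subset_rfl hxp, hpow x hx⟩
    · rw [key]
      refine adj_le (powField_le_one p n k) ?_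
      rintro _ ⟨_, ⟨i, hi, rfl⟩, rfl⟩
      exact hpow _ (hc i hi)
    · exact fun i hi => ⟨c i, subset_adj _ _ ⟨i, hi, rfl⟩, rfl⟩
    · rw [key]
      exact le_adj _ _
  obtain ⟨y, hy, hyx⟩ := this
  rwa [← frobenius_injective' p hyx]

theorem PIndep.pow_notMem (h : PIndep p (powField p 1 k) c) {J : Set ι} {z : Ω}
    (hc : ∀ i ∈ J, c i ∈ k) (hz : z ∈ k) (hzJ : z ∉ adj (powField p 1 k) (c '' J)) (m : ℕ) :
    z ^ p ^ m ∉ adj (powField p (m + 1) k) (c '' J) := by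
  induction m with
  | zero => simpa using hzJ
  | succ m ih =>
    intro hm
    rw [pow_succ, pow_mul] at hm
    exact ih (h.mem_adj_of_pow_mem p hc (pow_mem hz _) hm)

end PIndep

/-! ### Twisting a family -/

section Twist

variable {Ω : Type*} [Field Ω]

/-- The family `c` with `c i` replaced by `c i + u * c (i + s)` for all `i < s`. -/
def twist (s : ℕ) (u : Ω) (c : ℕ → Ω) (i : ℕ) : Ω :=
  if i < s then c i + u * c (i + s) else c i

theorem twist_of_lt {s i : ℕ} (h : i < s) (u : Ω) (c : ℕ → Ω) :
    twist s u c i = c i + u * c (i + s) := if_pos h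

theorem twist_of_le {s i : ℕ} (h : s ≤ i) (u : Ω) (c : ℕ → Ω) :
    twist s u c i = c i := if_neg h.not_gt

theorem eq_C_of_derivative_eq_zero (p : ℕ) [CharP Ω p] {f : Polynomial Ω} (hf : f.natDegree < p)
    (h : derivative f = 0) : f = C (f.coeff 0) := by
  ext m
  rcases m with _ | m
  · simp
  · rw [coeff_C_of_ne_zero (by simp)]
    by_cases hm : m + 1 < p
    · have h1 := congrArg (fun g => g.coeff m) h
      simp only [coeff_derivative, coeff_zero, mul_eq_zero] at h1
      refine h1.resolve_right fun h2 => ?_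
      have h3 : ((m + 1 : ℕ) : Ω) = 0 := by exact_mod_cast h2
      rw [CharP.cast_eq_zero_iff Ω p] at h3
      exact absurd (Nat.le_of_dvd (by omega) h3) (by omega)
    · exact coeff_eq_zero_of_natDegree_lt (by omega)

variable {p : ℕ} {Q : Subfield Ω} {s : ℕ} {u : Ω} {c : ℕ → Ω}

theorem twist_mem {F : Subfield Ω} (hu : u ∈ F) {J : Set ℕ} (hJ : ∀ i ∈ J, i < s → i + s ∈ J) {i : ℕ}
    (hi : i ∈ J) : twist s u c i ∈ adj F (c '' J) := by
  rcases lt_or_ge i s with h | h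
  · rw [twist_of_lt h]
    exact add_mem (subset_adj _ _ ⟨i, hi, rfl⟩)
      (mul_mem (le_adj _ _ hu) (subset_adj _ _ ⟨_, hJ i hi h, rfl⟩))
  · rw [twist_of_le h]
    exact subset_adj _ _ ⟨i, hi, rfl⟩

/-- The twist can be undone because the partners `c (i + s)` are themselves untwisted. -/
theorem mem_adj_twist {F : Subfield Ω} (hu : u ∈ F) {J : Set ℕ} (hJ : ∀ i ∈ J, i < s → i + s ∈ J) {i : ℕ}
    (hi : i ∈ J) : c i ∈ adj F (twist s u c '' J) := by
  rcases lt_or_ge i s with h | h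
  · have h1 : twist s u c i ∈ adj F (twist s u c '' J) := subset_adj _ _ ⟨i, hi, rfl⟩
    have h2 : twist s u c (i + s) ∈ adj F (twist s u c '' J) := subset_adj _ _ ⟨_, hJ i hi h, rfl⟩
    rw [twist_of_le (by omega)] at h2
    rw [twist_of_lt h] at h1
    simpa using sub_mem h1 (mul_mem (le_adj _ _ hu) h2)
  · rw [← twist_of_le h u c]
    exact subset_adj _ _ ⟨i, hi, rfl⟩

theorem adj_twist {F : Subfield Ω} (hu : u ∈ F) {J : Set ℕ} (hJ : ∀ i ∈ J, i < s → i + s ∈ J) :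
    adj F (twist s u c '' J) = adj F (c '' J) := by
  refine le_antisymm (adj_le (le_adj _ _) ?_) (adj_le (le_adj _ _) ?_)
  · rintro _ ⟨i, hi, rfl⟩
    exact twist_mem hu hJ hi
  · rintro _ ⟨i, hi, rfl⟩
    exact mem_adj_twist hu hJ hi

theorem adj_twist_range {F : Subfield Ω} (hu : u ∈ F) :
    adj F (Set.range (twist s u c)) = adj F (Set.range c) := by
  simpa using adj_twist (c := c) (s := s) hu (J := Set.univ) (by simp)

variable (p) [Fact p.Prime] [CharP Ω p]

theorem PIndep.twisted (h : PIndep p Q c) (hu : u ∈ Q) : PIndep p Q (twist s u c) := by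
  intro i
  constructor
  · rcases lt_or_ge i s with hi | hi
    · rw [twist_of_lt hi, add_pow_char, mul_pow]
      exact add_mem (h _).1 (mul_mem (pow_mem hu _) (h _).1)
    · rw [twist_of_le hi]
      exact (h _).1
  intro hi
  -- If `i = j + s` is a partner index, omitting it leaves `twist s u c j` without its partner, and
  -- the exchange property is needed. Otherwise the complement of `i` is closed under passing to
  -- partners and `adj_twist` applies.
  by_cases hcase : s ≤ i ∧ i < 2 * s
  · obtain ⟨j, rfl⟩ := Nat.exists_eq_add_of_le' hcase.1
    have hj : j < s := by omega
    rw [twist_of_le (by omega)] at hi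
    set B := adj Q (c '' {j, j + s}ᶜ) with hB
    have hle : adj Q (twist s u c '' {j + s}ᶜ) ≤ adj B {twist s u c j} := by
      refine adj_le ((le_adj _ _).trans (le_adj _ _)) ?_
      rintro _ ⟨l, hl, rfl⟩
      by_cases hlj : l = j
      · subst hlj
        exact subset_adj _ _ rfl
      · refine le_adj _ _ (twist_mem hu ?_ ?_)
        · simp only [Set.mem_compl_iff, Set.mem_insert_iff, Set.mem_singleton_iff]
          omega
        · simp only [Set.mem_compl_iff, Set.mem_insert_iff, Set.mem_singleton_iff] at hl ⊢
          omega
    have h1 := hle hi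
    have h2 : twist s u c j ∈ adj B {c (j + s)} := by
      refine mem_adj_singleton_exchange p ?_ h1 (h.notMem (by simp))
      rw [twist_of_lt hj, add_pow_char, mul_pow]
      exact le_adj _ _ (add_mem (h _).1 (mul_mem (pow_mem hu _) (h _).1))
    rw [hB, ← adj_image_insert] at h2
    rw [twist_of_lt hj] at h2
    have h3 := sub_mem h2 (mul_mem (le_adj _ _ hu)
      (subset_adj _ _ ⟨j + s, Set.mem_insert _ _, rfl⟩ :
        c (j + s) ∈ adj Q (c '' insert (j + s) {j, j + s}ᶜ)))
    rw [add_sub_cancel_right] at h3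
    refine h.notMem ?_ h3
    simp
    omega
  · rw [adj_twist hu (by simp only [Set.mem_compl_iff, Set.mem_singleton_iff]; omega)] at hi
    rcases lt_or_ge i s with his | his
    · rw [twist_of_lt his] at hi
      have h3 := sub_mem hi (mul_mem (le_adj _ _ hu) (subset_adj _ _ ⟨i + s, by simp; omega, rfl⟩ :
        c (i + s) ∈ adj Q (c '' {i}ᶜ)))
      rw [add_sub_cancel_right] at h3
      exact (h i).2 h3
    · rw [twist_of_le his] at hi
      exact (h i).2 hi

/-- An element which is both a polynomial in the `c i`, `i < s`, over `Q`, and a polynomial in the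
`twist s u c` over a small field `R` not containing `u`, is a constant. -/
theorem PIndep.mem_of_mem_adj_twist (h : PIndep p Q c) (hu : u ∈ Q) {R : Subfield Ω}
    (hRQ : R ≤ Q) (hcR : ∀ i, twist s u c i ^ p ∈ R)
    (huR : u ∉ adj R (Set.range (twist s u c))) {y : Ω}
    (hyR : y ∈ adj R (Set.range (twist s u c)))
    (hyQ : y ∈ adj Q (c '' Set.Iio s)) : y ∈ Q := by
  -- The generators `c i` are eliminated from the top: `y` is a polynomial `f` in the last one, and
  -- `f` turns out to be constant.
  suffices H : ∀ j ≤ s, y ∈ adj Q (c '' Set.Iio j) → y ∈ Q from H s le_rfl hyQ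
  clear hyQ
  intro j
  induction j with
  | zero => intro _ hy; simpa [adj_eq_self] using hy
  | succ i ih =>
    intro hi hy
    refine ih (by omega) ?_
    have hd := h.twisted p (s := s) hu
    set d := twist s u c with hd_def
    have hIio : Set.Iio (i + 1) = insert i (Set.Iio i) := by ext; simp
    rw [hIio, adj_image_insert] at hy
    obtain ⟨f, hf, hdeg, rfl⟩ := exists_eval_eq_of_mem_adj (Fact.out : p.Prime).pos
      (le_adj _ _ (h i).1) hy
    have hci : c i = d i - u * d (i + s) := by
      rw [hd_def, twist_of_lt (by omega), twist_of_le (by omega)]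
      ring
    have hB2 : adj Q (c '' Set.Iio i) ≤ adj Q (d '' {i, i + s}ᶜ) := by
      refine adj_le (le_adj _ _) ?_
      rintro _ ⟨l, hl, rfl⟩
      have hl' : l < i := hl
      refine mem_adj_twist hu ?_ ?_
      · simp only [Set.mem_compl_iff, Set.mem_insert_iff, Set.mem_singleton_iff]
        omega
      · simp only [Set.mem_compl_iff, Set.mem_insert_iff, Set.mem_singleton_iff]
        omega
    have hset : ({i + s}ᶜ : Set ℕ) = insert i ({i, i + s}ᶜ) := by
      ext l
      simp only [Set.mem_compl_iff, Set.mem_insert_iff, Set.mem_singleton_iff]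
      omega
    have hfB2 : ∀ m, f.coeff m ∈ adj Q (d '' {i, i + s}ᶜ) := fun m => hB2 (hf m)
    have hz : d i ∉ adj Q (d '' {i, i + s}ᶜ) := hd.notMem (by simp)
    set A := adj R (d '' {i + s}ᶜ) with hA
    set B := adj Q (d '' {i + s}ᶜ) with hB
    have hAz : A = adj (adj R (d '' {i, i + s}ᶜ)) {d i} := by rw [hA, hset, adj_image_insert]
    have hB2B : adj Q (d '' {i, i + s}ᶜ) ≤ B := by
      rw [hB, hset]
      exact adj_mono le_rfl (Set.image_mono (Set.subset_insert _ _))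
    have hzA : d i ∈ A := subset_adj _ _ ⟨i, by simp; omega, rfl⟩
    have hAB : A ≤ B := adj_mono hRQ subset_rfl
    have hAr : A ≤ adj R (Set.range d) := adj_mono le_rfl (Set.image_subset_range _ _)
    -- Since `c i = d i - u * d (i + s)`, the element `y` is the value of `F` at `d (i + s)`.
    -- Uniqueness puts the coefficients of `F` in `A`; the first two are `f(d i)` and `-u * f'(d
    -- i)`.
    set F : Polynomial Ω := f.comp (C (d i) - C u * X) with hF
    have hlin : (C (d i) - C u * X : Polynomial Ω).natDegree ≤ 1 := by compute_degree
    have hFdeg : F.natDegree < p :=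
      lt_of_le_of_lt (by
        rw [hF, natDegree_comp]
        calc f.natDegree * _ ≤ f.natDegree * 1 := Nat.mul_le_mul_left _ hlin
          _ = _ := mul_one _) hdeg
    have hlift : ∀ m, F.coeff m ∈ B := by
      obtain ⟨f', hf'⟩ := exists_map_eq fun m => hB2B (hfB2 m)
      intro m
      have : F = (f'.comp (C ⟨d i, hAB hzA⟩ - C ⟨u, le_adj _ _ hu⟩ * X)).map (algebraMap B Ω) := by
        rw [map_comp, hf', hF]
        simp [Algebra.algebraMap_eq_smul_one, Subfield.smul_def]
      rw [this]
      exact coeff_mem_algebraMap _ _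
    have hFA : ∀ m, F.coeff m ∈ A := by
      refine coeff_mem_of_eval_mem p hAB (g := d (i + s)) (le_adj _ _ (hcR _)) (hd.notMem (by simp))
        hlift hFdeg ?_
      rw [hA, ← adj_image_insert]
      have : insert (i + s) ({i + s}ᶜ : Set ℕ) = Set.univ := by ext l; simp; tauto
      rw [this, Set.image_univ]
      rw [hci] at hyR
      simpa [hF, eval_comp] using hyR
    have h0 : f.eval (d i) ∈ A := by
      have := hFA 0
      rw [coeff_zero_eq_eval_zero, hF, eval_comp] at this
      simpa using this
    have h1 : u * (derivative f).eval (d i) ∈ A := by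
      have := hFA 1
      have h2 : F.coeff 1 = (derivative F).eval 0 := by
        rw [← coeff_zero_eq_eval_zero, coeff_derivative]
        simp
      rw [h2, hF, derivative_comp, eval_mul, eval_comp] at this
      simpa using this
    have hfA2 := coeff_mem_of_eval_mem p (A := adj R (d '' {i, i + s}ᶜ)) (adj_mono hRQ subset_rfl)
      (le_adj _ _ (hcR i)) hz hfB2 hdeg (hAz ▸ h0)
    have hder : ∀ {E : Subfield Ω}, (∀ m, f.coeff m ∈ E) → ∀ m, (derivative f).coeff m ∈ E := by
      intro E hE m
      rw [coeff_derivative]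
      exact mul_mem (hE _) (add_mem (natCast_mem _ _) (one_mem _))
    have h2 : (derivative f).eval (d i) ∈ A :=
      eval_mem (hder fun m => hAz ▸ le_adj _ _ (hfA2 m)) hzA
    -- Otherwise dividing would put `u` in `A`, against `huR`.
    have h3 : (derivative f).eval (d i) = 0 := by
      by_contra hne
      exact huR (hAr (by simpa [hne] using div_mem h1 h2))
    have h4 : derivative f = 0 := by
      refine eq_zero_of_eval_eq_zero_of_notMem p hz (le_adj _ _ (hd i).1) (hder hfB2) ?_ h3
      exact (natDegree_derivative_le f).trans_lt (by omega)
    rw [eq_C_of_derivative_eq_zero p hdeg h4, eval_C]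
    exact hf 0

end Twist

/-! ### Linear disjointness by transfer of linear independence -/

section LinearDisjointness

variable {Ω : Type*} [Field Ω]

/-- Families of elements of `A` which are linearly independent over `F` are so over `B`. -/
def LinIndepTransfer (F A B : Subfield Ω) : Prop :=
  ∀ (n : ℕ) (x : Fin n → Ω), (∀ i, x i ∈ A) → LinearIndependent F x → LinearIndependent B x

theorem LinIndepTransfer.linearIndependent {F A B : Subfield Ω} (h : LinIndepTransfer F A B)
    {ι : Type*} {x : ι → Ω} (hx : ∀ i, x i ∈ A) (hF : LinearIndependent F x) :
    LinearIndependent B x := by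
  rw [linearIndependent_iff_finset_linearIndependent] at hF ⊢
  intro s
  have h1 := h _ ((x ∘ Subtype.val) ∘ s.equivFin.symm) (fun i => hx _)
    ((hF s).comp _ s.equivFin.symm.injective)
  have h2 := h1.comp _ s.equivFin.injective
  convert h2 using 1
  ext i
  simp

theorem linDisj_iff {A B : Subfield Ω} : LinDisj A B ↔ LinIndepTransfer (A ⊓ B) A B := by
  constructor
  · intro h n x hx hli
    have h1 : LinearIndependent ↥(A ⊓ B)
        (fun i => (⟨x i, hx i⟩ : Subfield.extendScalars (inf_le_left : A ⊓ B ≤ A))) :=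
      LinearIndependent.of_comp
        (Subfield.extendScalars (inf_le_left : A ⊓ B ≤ A)).val.toLinearMap hli
    exact IntermediateField.LinearDisjoint.linearIndependent_left h h1
  · intro h
    refine IntermediateField.LinearDisjoint.of_basis_left (Module.Basis.ofVectorSpace _ _) ?_
    refine h.linearIndependent (fun i => ((Module.Basis.ofVectorSpace _ _) i).2) ?_
    exact (Module.Basis.linearIndependent _).map'
      (Subfield.extendScalars (inf_le_left : A ⊓ B ≤ A)).val.toLinearMap
      (LinearMap.ker_eq_bot.2 Subtype.val_injective)

theorem span_mono_subfield {F B : Subfield Ω} (h : F ≤ B) {S : Set Ω} {x : Ω}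
    (hx : x ∈ Submodule.span F S) : x ∈ Submodule.span B S := by
  induction hx using Submodule.span_induction with
  | mem x hx => exact Submodule.subset_span hx
  | zero => exact zero_mem _
  | add x y _ _ hx hy => exact add_mem hx hy
  | smul a x _ hx => exact Submodule.smul_mem _ (⟨a, h a.2⟩ : B) hx

theorem smul_set_span {F : Subfield Ω} {S T : Set Ω} {a : Ω} (h : ∀ s ∈ S, s * a ∈ Submodule.span F T)
    {x : Ω} (hx : x ∈ Submodule.span F S) : x * a ∈ Submodule.span F T := by
  induction hx using Submodule.span_induction with
  | mem x hx => exact h x hx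
  | zero => simp
  | add x y _ _ hx hy => rw [add_mul]; exact add_mem hx hy
  | smul c x _ hx => rw [smul_mul_assoc]; exact Submodule.smul_mem _ _ hx

theorem mem_span_of_mem_adj {k P : Subfield Ω} (hP : ∀ x ∈ P, IsAlgebraic k x) {x : Ω}
    (hx : x ∈ adj k (P : Set Ω)) : x ∈ Submodule.span k (P : Set Ω) := by
  have hx' : x ∈ (IntermediateField.adjoin k (P : Set Ω)).toSubalgebra := hx
  rw [IntermediateField.adjoin_toSubalgebra_of_isAlgebraic hP] at hx'
  rw [← Algebra.adjoin_eq_span_of_subset]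
  · exact hx'
  · have : (P : Set Ω) = (P.toSubring.toSubmonoid : Set Ω) := rfl
    rw [this, Submonoid.closure_eq]
    exact Submodule.subset_span

/-- If `P` and `L` are linearly disjoint and `P ∩ L ⊆ k ⊆ L ⊆ k(P)` then `L = k`. -/
theorem le_of_linDisj {P L k : Subfield Ω} (h : LinDisj P L) (hPL : P ⊓ L ≤ k) (hkL : k ≤ L)
    (hL : L ≤ adj k (P : Set Ω)) (hP : ∀ x ∈ P, IsAlgebraic k x) : L ≤ k := by
  classical
  -- With a basis `b` of `P` over `P ∩ L` containing `1`, an element `l` of `L` is both `l * 1` and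
  -- a `k`-combination of `b`. As `b` is independent over `L`, the coefficients at `1` agree, so `l
  -- ∈ k`.
  obtain ⟨b, hbP, h1b, hPb, hb⟩ := exists_linearIndepOn_id_extension (K := ↥(P ⊓ L))
    (s := {(1 : Ω)}) (t := P) (LinearIndepOn.singleton one_ne_zero)
    (Set.singleton_subset_iff.2 (one_mem P))
  have hbL : LinearIndependent L (Subtype.val : b → Ω) :=
    (linDisj_iff.1 h).linearIndependent (fun i => hbP i.2) hb
  intro l hl
  have h1 : l ∈ Submodule.span k b := by
    have := mem_span_of_mem_adj hP (hL hl)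
    exact (Submodule.span_le (p := Submodule.span k b)).2 (fun x hx => span_mono_subfield hPL (hPb hx)) this
  obtain ⟨c, hcsum⟩ := (Finsupp.mem_span_iff_linearCombination k b l).1 h1
  set c' : b →₀ L := c.mapRange (fun z : k => (⟨z, hkL z.2⟩ : L)) rfl with hc'
  have h2 : Finsupp.linearCombination L (Subtype.val : b → Ω) c' =
      Finsupp.linearCombination L (Subtype.val : b → Ω)
        (Finsupp.single ⟨1, h1b rfl⟩ (⟨l, hl⟩ : L)) := by
    rw [Finsupp.linearCombination_single]
    have : Finsupp.linearCombination L (Subtype.val : b → Ω) c' = l := by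
      rw [← hcsum, Finsupp.linearCombination_apply, Finsupp.linearCombination_apply, hc',
        Finsupp.sum_mapRange_index (by simp)]
      rfl
    rw [this]
    simp [Subfield.smul_def]
  have h3 := DFunLike.congr_fun (hbL.finsuppLinearCombination_injective h2) ⟨1, h1b rfl⟩
  rw [Finsupp.single_eq_same] at h3
  have h4 : (l : Ω) = c ⟨1, h1b rfl⟩ := by
    rw [hc', Finsupp.mapRange_apply] at h3
    exact (congrArg Subtype.val h3).symm
  rw [h4]
  exact (c _).2

/-- If `A` and `k` are linearly disjoint and `L` is generated over `k` by elements of `A`, then `A`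
and `L` are linearly disjoint. -/
theorem LinDisj.of_adj {A L k : Subfield Ω} (h : LinDisj A k) (hkL : k ≤ L)
    (hL : L ≤ adj k ((A ⊓ L : Subfield Ω) : Set Ω)) (halg : ∀ x ∈ A, IsAlgebraic k x) :
    LinDisj A L := by
  classical
  rw [linDisj_iff]
  intro n x hx hli
  have hle : A ⊓ k ≤ A ⊓ L := inf_le_inf_left _ hkL
  let : Algebra ↥(A ⊓ k) ↥(A ⊓ L) := (Subfield.inclusion hle).toAlgebra
  have : IsScalarTower ↥(A ⊓ k) ↥(A ⊓ L) Ω := IsScalarTower.of_algebraMap_eq fun _ => rfl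
  -- The products of `e` with the given family are independent over `A ∩ k`, hence over `k`. As `e`
  -- spans `L` over `k`, a relation over `L` expands into one over `k` between these products.
  let e := Module.Basis.ofVectorSpace ↥(A ⊓ k) ↥(A ⊓ L)
  have hprod := linearIndependent_smul e.linearIndependent hli
  have hprodk := (linDisj_iff.1 h).linearIndependent (fun i => by
    rw [Subfield.smul_def]
    exact mul_mem (e i.1).2.1 (hx i.2)) hprod
  have hspan : ∀ l ∈ L, l ∈ Submodule.span k (Set.range fun i => (e i : Ω)) := by
    intro l hl
    have h1 := mem_span_of_mem_adj (P := A ⊓ L) (fun x hx => halg x hx.1) (hL hl)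
    refine (Submodule.span_le (p := Submodule.span k _)).2 (fun y hy => ?_) h1
    refine span_mono_subfield (F := A ⊓ k) inf_le_right ?_
    have h2 := e.mem_span (⟨y, hy⟩ : ↥(A ⊓ L))
    have h3 := Submodule.mem_map_of_mem (f := (IsScalarTower.toAlgHom ↥(A ⊓ k) ↥(A ⊓ L) Ω).toLinearMap) h2
    rw [Submodule.map_span, ← Set.range_comp] at h3
    exact h3
  rw [Fintype.linearIndependent_iff]
  intro g hg
  choose c hc using fun i => (Finsupp.mem_span_range_iff_exists_finsupp).1 (hspan (g i) (g i).2)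
  set S := Finset.univ.biUnion fun i => (c i).support with hS
  have hcS : ∀ i, ∑ l ∈ S, c i l • (e l : Ω) = g i := by
    intro i
    rw [← hc i, Finsupp.sum]
    symm
    refine Finset.sum_subset (fun l hl => ?_) (fun l _ hl => ?_)
    · rw [hS, Finset.mem_biUnion]
      exact ⟨i, Finset.mem_univ _, hl⟩
    · rw [Finsupp.notMem_support_iff.1 hl, zero_smul]
  have hzero := linearIndependent_iff'.1 hprodk (S ×ˢ Finset.univ) (fun li => c li.2 li.1) (by
    rw [Finset.sum_product_right, ← hg]
    refine Finset.sum_congr rfl fun i _ => ?_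
    rw [Subfield.smul_def, smul_eq_mul, ← hcS i, Finset.sum_mul]
    refine Finset.sum_congr rfl fun l _ => ?_
    simp [Subfield.smul_def, mul_assoc])
  intro i
  have h0 : (g i : Ω) = 0 := by
    rw [← hcS i]
    refine Finset.sum_eq_zero fun l hl => ?_
    rw [hzero (l, i) (by simp [hl]), zero_smul]
  exact_mod_cast h0

/-- `A` has a finite spanning family over `F` which is linearly independent over `B`. -/
def HasTransferBasis (F A B : Subfield Ω) : Prop :=
  ∃ (ι : Type) (_ : Fintype ι) (e : ι → Ω), (∀ i, e i ∈ A) ∧ LinearIndependent B e ∧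
    ∀ x ∈ A, x ∈ Submodule.span F (Set.range e)

theorem HasTransferBasis.refl (F B : Subfield Ω) : HasTransferBasis F F B := by
  refine ⟨Unit, inferInstance, fun _ => 1, fun _ => one_mem _, ?_, fun x hx => ?_⟩
  · rw [linearIndependent_unique_iff]
    exact one_ne_zero
  · have := Submodule.smul_mem (Submodule.span F (Set.range fun _ : Unit => (1 : Ω))) (⟨x, hx⟩ : F)
      (Submodule.subset_span ⟨(), rfl⟩)
    simpa [Subfield.smul_def] using this

theorem linearIndependent_of_le {F B : Subfield Ω} (h : F ≤ B) {ι : Type*} {x : ι → Ω}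
    (hx : LinearIndependent B x) : LinearIndependent F x := by
  let : Algebra F B := (Subfield.inclusion h).toAlgebra
  have : IsScalarTower F B Ω := IsScalarTower.of_algebraMap_eq fun _ => rfl
  exact hx.restrict_scalars' F

theorem HasTransferBasis.linIndepTransfer {F A B : Subfield Ω} (hFA : F ≤ A) (hFB : F ≤ B)
    (h : HasTransferBasis F A B) : LinIndepTransfer F A B := by
  obtain ⟨ι, _, e, heA, he, hspan⟩ := h
  intro n x hx hli
  let A' : IntermediateField F Ω := Subfield.extendScalars hFA
  let : Algebra F B := (Subfield.inclusion hFB).toAlgebra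
  have : IsScalarTower F B Ω := IsScalarTower.of_algebraMap_eq fun _ => rfl
  have heF : LinearIndependent F (fun i => (⟨e i, heA i⟩ : A')) :=
    LinearIndependent.of_comp A'.val.toLinearMap (linearIndependent_of_le hFB he)
  let b : Module.Basis ι F A' := Module.Basis.mk heF (by
    rintro ⟨y, hy⟩ _
    have h1 := hspan y hy
    have h2 : Set.range e = A'.val.toLinearMap '' Set.range (fun i => (⟨e i, heA i⟩ : A')) := by
      rw [← Set.range_comp]
      rfl
    rw [h2, ← Submodule.map_span] at h1
    obtain ⟨z, hz, hzy⟩ := h1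
    have : z = ⟨y, hy⟩ := Subtype.ext hzy
    rwa [← this])
  have hdis : A'.LinearDisjoint B := IntermediateField.LinearDisjoint.of_basis_left b (by
    have hb : A'.val ∘ b = e := by
      ext i
      simp [b]
    rw [hb]
    exact he)
  have h1 : LinearIndependent F (fun i => (⟨x i, hx i⟩ : A')) :=
    LinearIndependent.of_comp A'.val.toLinearMap hli
  exact hdis.linearIndependent_left h1

theorem linDisj_of_le {A B : Subfield Ω} (h : A ≤ B) : LinDisj A B := by
  rw [linDisj_iff, inf_eq_left.2 h]
  exact (HasTransferBasis.refl A B).linIndepTransfer le_rfl h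

/-- The degree of `g` is `p ^ (n + 1)` even over `B(A)`, so multiplying the old basis by the powers
of `g` below this degree preserves independence over `B`. -/
theorem HasTransferBasis.adj_singleton (p : ℕ) [Fact p.Prime] [CharP Ω p] {F A B : Subfield Ω}
    (h : HasTransferBasis F A B) {g : Ω} {n : ℕ} (hg : g ^ p ^ (n + 1) ∈ A)
    (hg' : g ^ p ^ n ∉ adj B (A : Set Ω)) : HasTransferBasis F (adj A {g}) B := by
  obtain ⟨ι, _, e, heA, he, hspan⟩ := h
  have hgA : g ∈ adj A {g} := subset_adj _ _ rfl
  refine ⟨ι × Fin (p ^ (n + 1)), inferInstance, fun l => e l.1 * g ^ (l.2 : ℕ),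
    fun l => mul_mem (le_adj _ _ (heA _)) (pow_mem hgA _), ?_, ?_⟩
  · rw [Fintype.linearIndependent_iff] at he ⊢
    intro c hc
    set f : Polynomial Ω := ∑ j : Fin (p ^ (n + 1)), C (∑ i, c (i, j) • e i) * X ^ (j : ℕ) with hf
    have hcoeff : ∀ j : Fin (p ^ (n + 1)), f.coeff j = ∑ i, c (i, j) • e i := by
      intro j
      rw [hf, finsetSum_coeff, Finset.sum_eq_single j]
      · rw [coeff_C_mul, coeff_X_pow, if_pos rfl, mul_one]
      · intro j' _ hj'
        rw [coeff_C_mul, coeff_X_pow, if_neg, mul_zero]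
        exact fun h => hj' (Fin.ext h.symm)
      · simp
    have hmem : ∀ j, (∑ i, c (i, j) • e i) ∈ adj B (A : Set Ω) := fun j => sum_mem fun i _ => by
      rw [Subfield.smul_def]
      exact mul_mem (le_adj _ _ (c _).2) (subset_adj _ _ (heA i))
    have hdeg : f.natDegree < p ^ (n + 1) := by
      have hpos : 0 < p ^ (n + 1) := pow_pos (Fact.out : p.Prime).pos _
      refine lt_of_le_of_lt (natDegree_sum_le_of_forall_le (n := p ^ (n + 1) - 1) _ _ fun j _ => ?_)
        (Nat.sub_lt hpos one_pos)
      exact (natDegree_C_mul_X_pow_le _ _).trans (by omega)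
    have hf0 : f = 0 := by
      refine eq_zero_of_eval_eq_zero p hg' (subset_adj _ _ hg) ?_ hdeg ?_
      · intro m
        by_cases hm : m < p ^ (n + 1)
        · rw [show f.coeff m = _ from hcoeff ⟨m, hm⟩]
          exact hmem _
        · rw [coeff_eq_zero_of_natDegree_lt (by omega)]
          exact zero_mem _
      · rw [← hc, hf, eval_finsetSum, Fintype.sum_prod_type_right]
        refine Finset.sum_congr rfl fun j _ => ?_
        rw [eval_mul, eval_C, eval_pow, eval_X, Finset.sum_mul]
        simp [Subfield.smul_def, mul_assoc]
    rintro ⟨i, j⟩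
    refine he (fun i => c (i, j)) ?_ i
    rw [← hcoeff, hf0, coeff_zero]
  · intro x hx
    obtain ⟨f, hf, hdeg, rfl⟩ := exists_eval_eq_of_mem_adj (pow_pos (Fact.out : p.Prime).pos _) hg hx
    rw [eval_eq_sum_range' hdeg]
    refine sum_mem fun j hj => smul_set_span ?_ (hspan _ (hf j))
    rintro _ ⟨i, rfl⟩
    exact Submodule.subset_span ⟨(i, ⟨j, Finset.mem_range.1 hj⟩), rfl⟩

end LinearDisjointness

/-! ### Finite and purely inseparable extensions, `r`-bases, modularity -/

section Extensions

variable {Ω : Type*} [Field Ω]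

theorem isAlgebraic_of_pow_mem {k : Subfield Ω} {x : Ω} {n : ℕ} (hn : 0 < n) (h : x ^ n ∈ k) :
    IsAlgebraic k x :=
  (isAlgebraic_algebraMap (⟨_, h⟩ : k) : IsAlgebraic k (x ^ n)).of_pow hn

theorem isFiniteExt_of_le_adj {k E : Subfield Ω} (hk : k ≤ E) {T : Set Ω} (hT : T.Finite)
    (halg : ∀ x ∈ T, IsAlgebraic k x) (hE : E ≤ adj k T) : IsFiniteExt k E := by
  refine ⟨hk, ?_⟩
  have h1 : FiniteDimensional k (IntermediateField.adjoin k T) := by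
    have := hT.to_subtype
    exact IntermediateField.finiteDimensional_adjoin fun x hx => (halg x hx).isIntegral
  have h2 : Subfield.extendScalars hk ≤ IntermediateField.adjoin k T := fun x hx => hE hx
  exact FiniteDimensional.of_injective (IntermediateField.inclusion h2).toLinearMap
    (IntermediateField.inclusion h2).injective

theorem IsFiniteExt.exists_finset {k E : Subfield Ω} (h : IsFiniteExt k E) :
    ∃ T : Finset Ω, E = adj k (T : Set Ω) := by
  obtain ⟨hk, _⟩ := h
  obtain ⟨T, hT⟩ := IntermediateField.fg_of_fg_toSubalgebra (Subfield.extendScalars hk)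
    (Subalgebra.fg_of_fg_toSubmodule (Module.Finite.iff_fg.1 ‹_›))
  refine ⟨T, ?_⟩
  rw [adj, hT]
  rfl

theorem IsFiniteExt.of_le {k E L : Subfield Ω} (h : IsFiniteExt k E) (hk : k ≤ L) (hL : L ≤ E) :
    IsFiniteExt k L := by
  obtain ⟨hkE, _⟩ := h
  have h2 : Subfield.extendScalars hk ≤ Subfield.extendScalars hkE := hL
  exact ⟨hk, FiniteDimensional.of_injective (IntermediateField.inclusion h2).toLinearMap
    (IntermediateField.inclusion h2).injective⟩

/-- A decreasing sequence of subextensions of a finite extension is stationary. -/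
theorem IsFiniteExt.exists_stationary {k E : Subfield Ω} (h : IsFiniteExt k E) {V : ℕ → Subfield Ω}
    (hk : ∀ n, k ≤ V n) (hE : ∀ n, V n ≤ E) (hV : Antitone V) : ∃ N, ∀ n ≥ N, V n = V N := by
  let d : ℕ → ℕ := fun n => Module.finrank k (Subfield.extendScalars (hk n))
  refine ⟨Function.argmin d, fun n hn => ?_⟩
  have hle : Subfield.extendScalars (hk n) ≤ Subfield.extendScalars (hk (Function.argmin d)) := hV hn
  have : FiniteDimensional k (Subfield.extendScalars (hk (Function.argmin d))) :=
    (h.of_le (hk _) (hE _)).2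
  have h1 := IntermediateField.eq_of_le_of_finrank_le hle (Function.argmin_le d n)
  have h2 := congrArg IntermediateField.toSubfield h1
  simpa using h2

theorem pow_mem_of_le (p : ℕ) {k : Subfield Ω} {x : Ω} {m n : ℕ} (hmn : m ≤ n) (h : x ^ p ^ m ∈ k) :
    x ^ p ^ n ∈ k := by
  obtain ⟨d, rfl⟩ := Nat.exists_eq_add_of_le hmn
  rw [pow_add, pow_mul]
  exact pow_mem h _

theorem pow_notMem_of_lt_elemExponent {p : ℕ} {F : Subfield Ω} {a : Ω} {n : ℕ}
    (h : n < elemExponent p F a) : a ^ p ^ n ∉ F :=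
  Nat.notMem_of_lt_sInf h

theorem elemExponent_eq {p : ℕ} {F : Subfield Ω} {a : Ω} {n : ℕ} (h : a ^ p ^ (n + 1) ∈ F)
    (h' : a ^ p ^ n ∉ F) : elemExponent p F a = n + 1 := by
  refine le_antisymm (Nat.sInf_le h) (le_csInf ⟨_, h⟩ fun m hm => ?_)
  by_contra hlt
  exact h' (pow_mem_of_le p (by omega) hm)

variable (p : ℕ) [Fact p.Prime] [CharP Ω p]

theorem isPurelyInsep_iff {F E : Subfield Ω} :
    IsPurelyInsep F E ↔ F ≤ E ∧ ∀ x ∈ E, ∃ m : ℕ, x ^ p ^ m ∈ F := by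
  have : ExpChar F p := RingHom.expChar (algebraMap F Ω) (algebraMap F Ω).injective p
  constructor
  · rintro ⟨h, hpi⟩
    refine ⟨h, fun x hx => ?_⟩
    obtain ⟨m, y, hy⟩ := (isPurelyInseparable_iff_pow_mem F p).1 hpi ⟨x, hx⟩
    refine ⟨m, ?_⟩
    have := congrArg Subtype.val hy
    have h2 : (y : Ω) = x ^ p ^ m := this
    exact h2 ▸ y.2
  · rintro ⟨h, hE⟩
    refine ⟨h, (isPurelyInseparable_iff_pow_mem F p).2 fun x => ?_⟩
    obtain ⟨m, hm⟩ := hE x x.2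
    exact ⟨m, ⟨_, hm⟩, Subtype.ext rfl⟩

theorem pow_mem_powField_one {E : Subfield Ω} {x : Ω} (hx : x ∈ E) : x ^ p ∈ powField p 1 E :=
  (mem_powField p).2 ⟨x, hx, by simp⟩

/-- Independence over `F(E^p)` is of finite character, and the exchange property shows that a
maximal independent set generates. -/
theorem exists_isRBase {F E : Subfield Ω} (hFE : F ≤ E) : ∃ B : Set Ω, IsRBase p F E B := by
  set D := adj F (powField p 1 E : Set Ω) with hD
  have hDE : D ≤ E := adj_le hFE (powField_le p 1 E)
  let Φ : Set (Set Ω) := {B | B ⊆ E ∧ ∀ x ∈ B, x ∉ adj D (B \ {x})}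
  have hΦ : Order.IsOfFiniteCharacter Φ := by
    intro B
    constructor
    · rintro ⟨hBE, hB⟩ Y hY -
      exact ⟨hY.trans hBE, fun x hx hxY => hB x (hY hx)
        (adj_mono le_rfl (Set.sdiff_subset_sdiff_left hY) hxY)⟩
    · intro h
      refine ⟨fun x hx => (h {x} (by simpa using hx) (Set.finite_singleton x)).1 rfl,
        fun x hx hxB => ?_⟩
      obtain ⟨T, hT, hxT⟩ := exists_finset_of_mem_adj hxB
      refine (h (insert x T) (Set.insert_subset hx fun y hy => (hT hy).1)
        (T.finite_toSet.insert x)).2 x (Set.mem_insert _ _) (adj_mono le_rfl ?_ hxT)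
      exact fun y hy => ⟨Set.mem_insert_of_mem _ hy, (hT hy).2⟩
  obtain ⟨B, -, hB, hmax⟩ := hΦ.exists_maximal (x := ∅) ⟨Set.empty_subset _, by simp⟩
  refine ⟨B, hB.1, ?_, fun x hx => by rw [adj_union]; exact hB.2 x hx⟩
  rw [adj_union]
  refine le_antisymm (adj_le hDE hB.1) fun x hx => ?_
  by_contra hxB
  have hxnB : x ∉ B := fun h => hxB (subset_adj _ _ h)
  refine hxnB (hmax (y := insert x B) ⟨Set.insert_subset hx hB.1, ?_⟩ (Set.subset_insert _ _)
    (Set.mem_insert _ _))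
  intro b hb hbB
  rcases Set.mem_insert_iff.1 hb with rfl | hbB'
  · rw [Set.insert_sdiff_self_of_notMem hxnB] at hbB
    exact hxB hbB
  · have hbx : x ≠ b := by
      rintro rfl
      exact hxnB hbB'
    rw [Set.insert_sdiff_of_notMem _ (by simpa using hbx), ← Set.union_singleton, adj_union] at hbB
    have h1 := mem_adj_singleton_exchange p (le_adj _ _ (subset_adj _ _ (pow_mem_powField_one p hx)))
      hbB (hB.2 b hbB')
    rw [← adj_union, Set.sdiff_union_of_subset (by simpa using hbB')] at h1
    exact hxB h1

theorem exists_isRBase_card_eq {F E : Subfield Ω} (hFE : F ≤ E) :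
    ∃ B : Set Ω, IsRBase p F E B ∧ Cardinal.mk B = rBaseCard p F E := by
  obtain ⟨B, hB⟩ := exists_isRBase p hFE
  exact csInf_mem (s := {c | ∃ B : Set Ω, IsRBase p F E B ∧ Cardinal.mk B = c}) ⟨_, B, hB, rfl⟩

/-- Substituting `E = F(E^p, B)` into itself gives `E = F(E^{p^m}, B)` for all `m`; bounded exponent
absorbs the powers into `F`. -/
theorem adj_eq_of_isRBase {F E : Subfield Ω} {B : Set Ω} {n : ℕ} (hB : IsRBase p F E B)
    (hE : ∀ x ∈ E, x ^ p ^ n ∈ F) : adj F B = E := by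
  obtain ⟨hBE, hgen, -⟩ := hB
  have hFE : F ≤ E := hgen ▸ le_adj _ _
  have key : ∀ m, E ≤ adj F (powField p m E ∪ B) := by
    intro m
    induction m with
    | zero =>
      intro x hx
      exact subset_adj _ _ (Or.inl ((mem_powField p).2 ⟨x, hx, by simp⟩))
    | succ m ih =>
      conv_lhs => rw [← hgen]
      refine adj_le (le_adj _ _) (Set.union_subset ?_ (Set.subset_union_right.trans (subset_adj _ _)))
      intro x hx
      obtain ⟨y, hy, rfl⟩ := (mem_powField p).1 hx
      have h1 : y ^ p ^ 1 ∈ (adj F (powField p m E ∪ B)).map (frobenius Ω p) :=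
        ⟨y, ih hy, by simp [frobenius_def]⟩
      rw [map_adj] at h1
      refine adj_le ?_ ?_ h1
      · rintro _ ⟨z, hz, rfl⟩
        exact le_adj _ _ (pow_mem hz p)
      · rintro _ ⟨z, hz | hz, rfl⟩
        · refine subset_adj _ _ (Or.inl ?_)
          rw [← map_frobenius_powField]
          exact ⟨z, hz, rfl⟩
        · have hz' : z ∈ adj F (powField p (m + 1) E ∪ B) := subset_adj _ _ (Or.inr hz)
          exact pow_mem hz' p
  refine le_antisymm (adj_le hFE hBE) ((key n).trans (adj_le (le_adj _ _) (Set.union_subset ?_ (subset_adj _ _))))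
  intro x hx
  obtain ⟨y, hy, rfl⟩ := (mem_powField p).1 hx
  exact le_adj _ _ (hE y hy)

variable {p}

theorem isModular_of_pow_mem_or_linDisj {k M : Subfield Ω} {n : ℕ} (hkM : k ≤ M)
    (hn : ∀ x ∈ M, x ^ p ^ n ∈ k) (h : ∀ r < n, LinDisj (powField p r M) k) : IsModular p k M := by
  refine ⟨(isPurelyInsep_iff p).2 ⟨hkM, fun x hx => ⟨n, hn x hx⟩⟩, fun r => ?_⟩
  rcases lt_or_ge r n with hr | hr
  · exact h r hr
  · refine linDisj_of_le fun x hx => ?_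
    obtain ⟨y, hy, rfl⟩ := (mem_powField p).1 hx
    exact pow_mem_of_le p hr (hn y hy)

theorem map_iterateFrobenius_adj (r : ℕ) (F : Subfield Ω) (S : Set Ω) :
    powField p r (adj F S) = adj (powField p r F) ((fun x => x ^ p ^ r) '' S) := by
  rw [powField, map_adj, powField]
  congr 2

/-- The `p^r`-th powers of the `r`-base generate `M^{p^r}` over `M^{p^r} ∩ k`. Each has the same
degree `p^{n-r}` over this field as over `k` with the others adjoined, so their monomials give bases
that stay independent over `k`. -/
theorem IsEquiexponential.isModular {k M : Subfield Ω} {n : ℕ} (h : IsEquiexponential p k M n) :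
    IsModular p k M := by
  classical
  obtain ⟨hpi, hexp, G, hG, hGn⟩ := h
  have hkM : k ≤ M := hpi.1
  have hMG : adj k G = M := adj_eq_of_isRBase p hG hexp.1
  refine isModular_of_pow_mem_or_linDisj hkM hexp.1 fun r hr => ?_
  rw [linDisj_iff]
  obtain ⟨e, rfl⟩ : ∃ e, n = r + (e + 1) := ⟨n - r - 1, by omega⟩
  set F := powField p r M ⊓ k with hF
  let A : Set Ω → Subfield Ω := fun T => adj F ((fun x => x ^ p ^ r) '' T)
  have hbasis : ∀ T : Finset Ω, (T : Set Ω) ⊆ G → HasTransferBasis F (A T) k := by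
    intro T
    induction T using Finset.induction_on with
    | empty =>
      intro _
      have : A ((∅ : Finset Ω) : Set Ω) = F := by simp [A, adj_eq_self]
      rw [this]
      exact HasTransferBasis.refl _ _
    | insert g T hgT ih =>
      intro hT
      have hTG : (T : Set Ω) ⊆ G := fun x hx => hT (by simp at hx ⊢; tauto)
      have hgG : g ∈ G := hT (by simp)
      have hA : A ((insert g T : Finset Ω) : Set Ω) = adj (A T) {g ^ p ^ r} := by
        simp only [A]
        rw [Finset.coe_insert, adj_image_insert]
      rw [hA]
      refine (ih hTG).adj_singleton p (n := e) ?_ ?_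
      · rw [← pow_mul, ← pow_add]
        refine le_adj _ _ ⟨(mem_powField p).2 ⟨g ^ p ^ (e + 1), pow_mem (hG.1 hgG) _, ?_⟩, hexp.1 g (hG.1 hgG)⟩
        rw [← pow_mul, ← pow_add, add_comm]
      · rw [← pow_mul, ← pow_add]
        intro hmem
        -- Everything adjoined so far lies in `k(G \ {g})`, over which `g` still has exponent `n = r
        -- + e + 1`.
        refine pow_notMem_of_lt_elemExponent (p := p) (F := adj k (G \ {g})) (a := g) (n := r + e)
          (by rw [(hGn g hgG).1]; omega) (adj_le (le_adj _ _) ?_ hmem)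
        refine adj_le (inf_le_right.trans (le_adj _ _)) ?_
        rintro _ ⟨x, hx, rfl⟩
        have hxG : x ∈ adj k (G \ {g}) := subset_adj _ _ ⟨hTG hx, by
          rintro rfl
          exact hgT (by simpa using hx)⟩
        exact pow_mem hxG _
  intro m x hx hli
  have hfin : ∀ i, ∃ T : Finset Ω, (T : Set Ω) ⊆ G ∧ x i ∈ A T := by
    intro i
    obtain ⟨y, hy, hyx⟩ := (mem_powField p).1 (hx i)
    rw [← hMG] at hy
    obtain ⟨T, hT, hyT⟩ := exists_finset_of_mem_adj hy
    refine ⟨T, hT, ?_⟩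
    have h1 : x i ∈ powField p r (adj k (T : Set Ω)) := (mem_powField p).2 ⟨y, hyT, hyx⟩
    rw [map_iterateFrobenius_adj] at h1
    refine adj_mono ?_ subset_rfl h1
    refine le_inf (fun z hz => ?_) (powField_le p r k)
    obtain ⟨w, hw, rfl⟩ := (mem_powField p).1 hz
    exact (mem_powField p).2 ⟨w, hkM hw, rfl⟩
  choose T hTG hxT using hfin
  refine (hbasis (Finset.univ.biUnion T) ?_).linIndepTransfer (le_adj _ _) inf_le_right m x ?_ hli
  · intro y hy
    simp only [Finset.coe_biUnion, Set.mem_iUnion] at hy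
    obtain ⟨i, -, hi⟩ := hy
    exact hTG i hi
  · intro i
    refine adj_mono le_rfl (Set.image_mono fun y hy => ?_) (hxT i)
    simp only [Finset.coe_biUnion, Set.mem_iUnion]
    exact ⟨i, by simp, hy⟩

end Extensions

/-! ### Construction of the tower -/

section Construction

theorem exists_pow_eq {Ω : Type*} [Field Ω] [IsAlgClosed Ω] (p : ℕ) [Fact p.Prime] (n : ℕ) (x : Ω) :
    ∃ y, y ^ p ^ n = x :=
  IsAlgClosed.exists_pow_nat_eq x (pow_pos (Fact.out : p.Prime).pos n)

variable {Ω : Type*} [Field Ω] {p : ℕ} [Fact p.Prime] [CharP Ω p] {k : Subfield Ω}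

theorem IsPFree.pIndep {ι : Type*} {Y : ι → Ω} (h : IsPFree p k Y) : PIndep p (powField p 1 k) Y :=
  fun i => ⟨pow_mem_powField_one p (h.1 i), h.2 i⟩

variable (p k) in
/-- The field generated over `k` by the `p ^ n`-th roots of the `c i`. -/
def rootExt (n : ℕ) (c : ℕ → Ω) : Subfield Ω :=
  rootField p n (adj (powField p n k) (Set.range c))

theorem mem_rootExt {n : ℕ} {c : ℕ → Ω} {x : Ω} :
    x ∈ rootExt p k n c ↔ x ^ p ^ n ∈ adj (powField p n k) (Set.range c) := mem_rootField p

theorem pow_injective (n : ℕ) : Function.Injective fun x : Ω => x ^ p ^ n :=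
  (iterateFrobenius Ω p n).injective

theorem pow_mem_adj_of_mem_adj {n : ℕ} {S : Set Ω} {x : Ω} (hx : x ∈ adj k S) :
    x ^ p ^ n ∈ adj (powField p n k) ((fun x => x ^ p ^ n) '' S) := by
  rw [← map_iterateFrobenius_adj]
  exact (mem_powField p).2 ⟨x, hx, rfl⟩

theorem mem_of_pow_mem_powField {n : ℕ} {x : Ω} (hx : x ^ p ^ n ∈ powField p n k) : x ∈ k := by
  obtain ⟨y, hy, hyx⟩ := (mem_powField p).1 hx
  rwa [← pow_injective (p := p) n hyx]

theorem rootExt_eq_adj [IsAlgClosed Ω] (n : ℕ) (c : ℕ → Ω) :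
    rootExt p k n c = adj k {y | ∃ i, y ^ p ^ n = c i} := by
  have himage : (fun x => x ^ p ^ n) '' {y | ∃ i, y ^ p ^ n = c i} = Set.range c := by
    ext x
    constructor
    · rintro ⟨y, ⟨i, hi⟩, rfl⟩
      exact ⟨i, hi.symm⟩
    · rintro ⟨i, rfl⟩
      obtain ⟨y, hy⟩ := exists_pow_eq p n (c i)
      exact ⟨y, ⟨i, hy⟩, hy⟩
  refine le_antisymm (fun x hx => ?_) fun x hx => ?_
  · rw [mem_rootExt, ← himage, ← map_iterateFrobenius_adj] at hx
    exact mem_of_pow_mem_powField hx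
  · rw [mem_rootExt, ← himage]
    exact pow_mem_adj_of_mem_adj hx

theorem le_rootExt (n : ℕ) (c : ℕ → Ω) : k ≤ rootExt p k n c := fun x hx =>
  mem_rootExt.2 (le_adj _ _ ((mem_powField p).2 ⟨x, hx, rfl⟩))

theorem rootExt_le_succ (n : ℕ) (c : ℕ → Ω) : rootExt p k n c ≤ rootExt p k (n + 1) c := by
  intro x hx
  rw [mem_rootExt] at hx ⊢
  have h1 : (x ^ p ^ n) ^ p ∈ (adj (powField p n k) (Set.range c)).map (frobenius Ω p) :=
    ⟨_, hx, rfl⟩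
  rw [map_adj, map_frobenius_powField] at h1
  rw [pow_succ, pow_mul]
  refine adj_le (le_adj _ _) ?_ h1
  rintro _ ⟨y, hy, rfl⟩
  have hy' : y ∈ adj (powField p (n + 1) k) (Set.range c) := subset_adj _ _ hy
  exact pow_mem hy' p

/-- The twisting coefficient `t ^ p ^ n` lies in `k^{p^n}`, so level `n` does not see the twist. -/
theorem rootExt_twist {n s : ℕ} {t : Ω} (ht : t ∈ k) (c : ℕ → Ω) :
    rootExt p k n (twist s (t ^ p ^ n) c) = rootExt p k n c := by
  rw [rootExt, adj_twist_range ((mem_powField p).2 ⟨t, ht, rfl⟩), rootExt]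

variable {c : ℕ → Ω}

theorem adj_powField_range_le (n : ℕ) (hc : ∀ i, c i ∈ k) :
    adj (powField p n k) (Set.range c) ≤ k :=
  adj_le (powField_le p n k) (by rintro _ ⟨i, rfl⟩; exact hc i)

theorem pow_mem_of_mem_rootExt {n : ℕ} (hc : ∀ i, c i ∈ k) {x : Ω} (hx : x ∈ rootExt p k n c) :
    x ^ p ^ n ∈ k :=
  adj_powField_range_le n hc (mem_rootExt.1 hx)

theorem PIndep.rootField_inf_rootExt (h : PIndep p (powField p 1 k) c) (hc : ∀ i, c i ∈ k) (n : ℕ) :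
    rootField p n k ⊓ rootExt p k (n + 1) c = rootExt p k n c := by
  refine le_antisymm ?_ (le_inf (fun x hx => ?_) (rootExt_le_succ n c))
  · rintro x ⟨hxk, hx⟩
    have hxk' := (mem_rootField p).1 hxk
    have hx' := mem_rootExt.1 hx
    rw [mem_rootExt, ← Set.image_univ]
    refine h.mem_adj_of_pow_mem p (fun i _ => hc i) hxk' ?_
    rwa [Set.image_univ, ← pow_mul, ← pow_succ]
  · exact (mem_rootField p).2 (pow_mem_of_mem_rootExt hc hx)

theorem PIndep.isEquiexponential [IsAlgClosed Ω] (h : PIndep p (powField p 1 k) c)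
    (hc : ∀ i, c i ∈ k) (n : ℕ) : IsEquiexponential p k (rootExt p k (n + 1) c) (n + 1) := by
  set M := rootExt p k (n + 1) c with hM
  have hMk : ∀ x ∈ M, x ^ p ^ (n + 1) ∈ k := fun x hx => pow_mem_of_mem_rootExt hc hx
  choose a ha using fun i => exists_pow_eq p (n + 1) (c i)
  have haM : ∀ i, a i ∈ M := fun i => mem_rootExt.2 (by rw [ha]; exact subset_adj _ _ ⟨i, rfl⟩)
  have hgen : M = adj k (Set.range a) := by
    rw [hM, rootExt_eq_adj]
    congr 1
    ext y
    constructor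
    · rintro ⟨i, hi⟩
      exact ⟨i, pow_injective (p := p) (n + 1) ((ha i).trans hi.symm)⟩
    · rintro ⟨i, rfl⟩
      exact ⟨i, ha i⟩
  have hdiff : ∀ i, (fun x => x ^ p ^ (n + 1)) '' (Set.range a \ {a i}) ⊆ c '' {i}ᶜ := by
    rintro i _ ⟨_, ⟨⟨j, rfl⟩, hj⟩, rfl⟩
    refine ⟨j, ?_, (ha j).symm⟩
    rintro rfl
    exact hj rfl
  have hnot : ∀ i, a i ^ p ^ n ∉ adj k (Set.range a \ {a i}) := by
    intro i hi
    have h1 := pow_mem_adj_of_mem_adj (n := n + 1) hi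
    refine h.pow_notMem p (fun j _ => hc j) (hc i) (h i).2 n (adj_mono le_rfl (hdiff i) ?_)
    have h2 : c i ^ p ^ n = (a i ^ p ^ n) ^ p ^ (n + 1) := by
      rw [← ha i, ← pow_mul, ← pow_mul, mul_comm]
    rwa [h2]
  have hnotk : ∀ i, a i ^ p ^ n ∉ k := fun i hi => hnot i (le_adj _ _ hi)
  refine ⟨(isPurelyInsep_iff p).2 ⟨le_rootExt _ _, fun x hx => ⟨_, hMk x hx⟩⟩, ⟨hMk, fun m hm => ?_⟩,
    Set.range a, ⟨?_, ?_, ?_⟩, ?_⟩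
  · by_contra hlt
    exact hnotk 0 (pow_mem_of_le p (by omega) (hm _ (haM 0)))
  · rintro _ ⟨i, rfl⟩
    exact haM i
  · refine le_antisymm (adj_le (le_rootExt _ _) (Set.union_subset (powField_le p 1 M) ?_)) ?_
    · rintro _ ⟨i, rfl⟩
      exact haM i
    · conv_lhs => rw [hgen]
      exact adj_mono le_rfl Set.subset_union_right
  · rintro _ ⟨i, rfl⟩ hi
    have h1 := pow_mem_adj_of_mem_adj (n := n + 1) hi
    simp only [ha] at h1
    refine (h i).2 (adj_le ((powField_le_one p n k).trans (le_adj _ _)) ?_ h1)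
    rw [Set.image_union]
    refine Set.union_subset ?_ ((hdiff i).trans (subset_adj _ _))
    rintro _ ⟨x, hx, rfl⟩
    obtain ⟨y, hy, rfl⟩ := (mem_powField p).1 hx
    refine le_adj _ _ ((mem_powField p).2 ⟨_, hMk y hy, ?_⟩)
    change _ = (y ^ p ^ 1) ^ p ^ (n + 1)
    rw [← pow_mul, ← pow_mul, mul_comm]
  · rintro _ ⟨i, rfl⟩
    have h1 : a i ^ p ^ (n + 1) ∈ k := by rw [ha]; exact hc i
    exact ⟨elemExponent_eq (le_adj _ _ h1) (hnot i), elemExponent_eq h1 (hnotk i)⟩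

theorem twist_mem_base {s : ℕ} {u : Ω} (hu : u ∈ k) (hc : ∀ i, c i ∈ k) (i : ℕ) :
    twist s u c i ∈ k := by
  rw [twist]
  split_ifs
  exacts [add_mem (hc _) (mul_mem hu (hc _)), hc _]

theorem pow_mem_powField_one_of_pos {t : Ω} (ht : t ∈ k) {n : ℕ} (hn : 1 ≤ n) :
    t ^ p ^ n ∈ powField p 1 k := by
  obtain ⟨m, rfl⟩ := Nat.exists_eq_add_of_le' hn
  exact powField_le_one p m k ((mem_powField p).2 ⟨t, ht, rfl⟩)

theorem PIndep.not_isModular [IsAlgClosed Ω] (h : PIndep p (powField p 1 k) c) (hc : ∀ i, c i ∈ k)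
    {t : Ω} (ht : t ∈ k) (htc : t ∉ adj (powField p 1 k) (Set.range c)) {L : Subfield Ω} (hkL : k < L)
    {s : ℕ} (hL : ∀ y ∈ L, y ^ p ∈ adj (powField p 1 k) (c '' Set.Iio s)) {n : ℕ} (hn : 1 ≤ n) :
    ¬ IsModular p L (rootExt p k (n + 1) (twist s (t ^ p ^ n) c)) := by
  rintro ⟨-, hmod⟩
  set u := t ^ p ^ n with hu_def
  have hu : u ∈ powField p 1 k := pow_mem_powField_one_of_pos ht hn
  set d := twist s u c with hd_def
  have hd : PIndep p (powField p 1 k) d := h.twisted p hu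
  have hdk : ∀ i, d i ∈ k := twist_mem_base (pow_mem ht _) hc
  have hadj : adj (powField p 1 k) (Set.range d) = adj (powField p 1 k) (Set.range c) :=
    adj_twist_range hu
  set M := rootExt p k (n + 1) d with hM
  refine hkL.not_ge (le_of_linDisj (hmod n) ?_ hkL.le ?_ ?_)
  · rintro y ⟨hyP, hyL⟩
    obtain ⟨z, hz, rfl⟩ := (mem_powField p).1 hyP
    have hzN := mem_rootExt.1 hz
    rw [pow_succ, pow_mul] at hzN
    -- The `d i ^ p` are included to meet the hypothesis on `p`-th powers; `R(d)` is still
    -- `k^{p^{n+1}}(d)`.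
    set R := adj (powField p (n + 1) k) (Set.range fun i => d i ^ p) with hR
    have hRd : adj R (Set.range d) = adj (powField p (n + 1) k) (Set.range d) := by
      refine le_antisymm (adj_le (adj_le (le_adj _ _) ?_) (subset_adj _ _)) (adj_mono (le_adj _ _) subset_rfl)
      rintro _ ⟨i, rfl⟩
      have hdi : d i ∈ adj (powField p (n + 1) k) (Set.range d) := subset_adj _ _ ⟨i, rfl⟩
      exact pow_mem hdi p
    have h1 := h.mem_of_mem_adj_twist p (s := s) hu (R := R) (adj_le (powField_le_one p n k) ?_)
      (fun i => subset_adj _ _ ⟨i, rfl⟩) ?_ (hRd ▸ hzN) (hL _ hyL)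
    · exact mem_of_pow_mem_powField (p := p) (n := 1) (by simpa using h1)
    · rintro _ ⟨i, rfl⟩
      exact pow_mem_powField_one p (hdk i)
    · change u ∉ adj R (Set.range d)
      rw [hRd]
      have := hd.pow_notMem p (J := Set.univ) (fun i _ => hdk i) ht (by simpa [hadj] using htc) n
      simpa using this
  -- `L` lies in the field generated over `k` by the `p`-th roots of the `d i`, which are `p^n`-th
  -- powers of their `p^{n+1}`-th roots.
  · intro l hl
    have h1 : l ∈ rootExt p k 1 d := by
      rw [mem_rootExt, hadj, pow_one]
      exact adj_mono le_rfl (Set.image_subset_range _ _) (hL l hl)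
    rw [rootExt_eq_adj] at h1
    refine adj_mono le_rfl ?_ h1
    rintro y ⟨i, hi⟩
    obtain ⟨z, rfl⟩ := exists_pow_eq p n y
    refine (mem_powField p).2 ⟨z, mem_rootExt.2 ?_, rfl⟩
    rw [← pow_mul, ← pow_add] at hi
    rw [hi]
    exact subset_adj _ _ ⟨i, rfl⟩
  · intro x hx
    refine isAlgebraic_of_pow_mem (pow_pos (Fact.out : p.Prime).pos (n + 1)) (n := p ^ (n + 1)) ?_
    exact pow_mem_of_mem_rootExt hdk (powField_le p n M hx)

theorem adjRoots_eq_rootExt [IsAlgClosed Ω] (X : ℕ → Ω) (n : ℕ) :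
    adjRoots p k X n = rootExt p k n X := (rootExt_eq_adj n X).symm

/-- Finitely many generators of `L` involve finitely many members of `c`. -/
theorem IsFiniteExt.exists_pow_mem_adj_Iio {L : Subfield Ω} (hfin : IsFiniteExt k L)
    (hL : L ≤ rootExt p k 1 c) : ∃ s, ∀ y ∈ L, y ^ p ∈ adj (powField p 1 k) (c '' Set.Iio s) := by
  classical
  obtain ⟨T, rfl⟩ := hfin.exists_finset
  have hT : ∀ y : T, ∃ J : Finset ℕ, (y : Ω) ^ p ∈ adj (powField p 1 k) (c '' (J : Set ℕ)) := by
    intro y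
    have h1 := mem_rootExt.1 (hL (subset_adj _ _ y.2))
    rw [pow_one, ← Set.image_univ] at h1
    obtain ⟨J, -, hJ⟩ := exists_finset_of_mem_adj_image h1
    exact ⟨J, hJ⟩
  choose J hJ using hT
  refine ⟨(Finset.univ.biUnion J).sup id + 1, fun y hy => ?_⟩
  have h1 := pow_mem_adj_of_mem_adj (p := p) (n := 1) hy
  simp only [pow_one] at h1
  refine adj_le (le_adj _ _) ?_ h1
  rintro _ ⟨z, hz, rfl⟩
  refine adj_mono le_rfl (Set.image_mono fun i hi => ?_) (hJ ⟨z, hz⟩)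
  have : i ∈ Finset.univ.biUnion J := Finset.mem_biUnion.2 ⟨_, Finset.mem_univ _, hi⟩
  exact Nat.lt_succ_of_le (Finset.le_sup (f := id) this)

variable (p k) in
/-- The number of members of `c` whose `p`-th roots are needed to generate a field containing `L`. -/
def supportBound (L : Subfield Ω) (c : ℕ → Ω) : ℕ :=
  sInf {s | ∀ y ∈ L, y ^ p ∈ adj (powField p 1 k) (c '' Set.Iio s)}

variable (p k) in
/-- The successively twisted families. -/
def twistSeq (X : ℕ → Ω) (t : Ω) (L : ℕ → Subfield Ω) : ℕ → ℕ → Ω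
  | 0 => X
  | m + 1 => twist (supportBound p k (L (m + 3)) (twistSeq X t L m)) (t ^ p ^ (m + 2))
      (twistSeq X t L m)

theorem twistSeq_spec {X : ℕ → Ω} {t : Ω} (ht : t ∈ k) (hX : PIndep p (powField p 1 k) X)
    (hXk : ∀ i, X i ∈ k) (L : ℕ → Subfield Ω) (m : ℕ) :
    PIndep p (powField p 1 k) (twistSeq p k X t L m) ∧ (∀ i, twistSeq p k X t L m i ∈ k) ∧
      adj (powField p 1 k) (Set.range (twistSeq p k X t L m)) = adj (powField p 1 k) (Set.range X) := by
  induction m with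
  | zero => exact ⟨hX, hXk, rfl⟩
  | succ m ih =>
    have hu := pow_mem_powField_one_of_pos (p := p) ht (n := m + 2) (by omega)
    refine ⟨ih.1.twisted p hu, twist_mem_base (pow_mem ht _) ih.2.1, ?_⟩
    rw [twistSeq, adj_twist_range hu, ih.2.2]

theorem exists_isTower [IsAlgClosed Ω] {X : ℕ → Ω} {t : Ω} (ht : t ∈ k)
    (hX : PIndep p (powField p 1 k) X) (hXk : ∀ i, X i ∈ k)
    (htX : t ∉ adj (powField p 1 k) (Set.range X)) {L : ℕ → Subfield Ω}
    (hL : ∀ n, 3 ≤ n → L n ∈ properFiniteSubexts p k X) : ∃ M, IsTower p k X L M := by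
  have hc := twistSeq_spec (p := p) ht hX hXk L
  -- The family for `M (n + 1)` also yields `M n`, so consecutive levels can be compared within one
  -- family. Truncated subtraction gives levels 1 and 2 the untwisted `X`.
  have hstep : ∀ n, 1 ≤ n → rootExt p k n (twistSeq p k X t L (n - 2)) =
      rootExt p k n (twistSeq p k X t L (n + 1 - 2)) := by
    intro n hn
    rcases n with _ | _ | m
    · omega
    · rfl
    · exact (rootExt_twist ht _).symm
  refine ⟨fun n => rootExt p k n (twistSeq p k X t L (n - 2)), ?_, ?_, ?_, ?_, ?_, ?_⟩
  · exact (adjRoots_eq_rootExt X 1).symm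
  · exact (adjRoots_eq_rootExt X 2).symm
  · intro n hn
    simp only [hstep n hn]
    exact rootExt_le_succ _ _
  · intro n hn
    simp only [hstep n hn]
    exact (hc _).1.rootField_inf_rootExt (hc _).2.1 n
  · intro n hn
    obtain ⟨m, rfl⟩ := Nat.exists_eq_add_of_le' hn
    exact (hc _).1.isEquiexponential (hc _).2.1 _
  · intro n hn
    obtain ⟨m, rfl⟩ := Nat.exists_eq_add_of_le' hn
    obtain ⟨hkL, hLM, hfin⟩ := hL _ hn
    have hLc : L (m + 3) ≤ rootExt p k 1 (twistSeq p k X t L m) := by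
      rw [adjRoots_eq_rootExt] at hLM
      rw [rootExt, (hc m).2.2]
      exact hLM.le
    exact (hc m).1.not_isModular (hc m).2.1 ht (by rwa [(hc m).2.2]) hkL
      (Nat.sInf_mem (hfin.exists_pow_mem_adj_Iio hLc)) (n := m + 2) (by omega)

end Construction

/-! ### Properties of an arbitrary tower and of its union -/

section Tower

variable {Ω : Type*} [Field Ω] {p : ℕ} [Fact p.Prime] [CharP Ω p] {k : Subfield Ω}

theorem PIndep.not_isFiniteExt_rootExt [IsAlgClosed Ω] {X : ℕ → Ω}
    (hX : PIndep p (powField p 1 k) X) : ¬ IsFiniteExt k (rootExt p k 1 X) := by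
  intro h
  obtain ⟨s, hs⟩ := h.exists_pow_mem_adj_Iio le_rfl
  obtain ⟨y, hy⟩ := exists_pow_eq p 1 (X s)
  have h1 := hs y (mem_rootExt.2 (hy ▸ subset_adj _ _ ⟨s, rfl⟩))
  rw [pow_one] at hy
  rw [hy] at h1
  exact hX.notMem (by simp) h1

theorem isFiniteExt_of_isRBase {E : Subfield Ω} {B : Set Ω} {n : ℕ} (hB : IsRBase p k E B)
    (hE : ∀ x ∈ E, x ^ p ^ n ∈ k) (hfin : B.Finite) : IsFiniteExt k E := by
  have h1 := adj_eq_of_isRBase p hB hE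
  exact isFiniteExt_of_le_adj (h1 ▸ le_adj _ _) hfin
    (fun x hx => isAlgebraic_of_pow_mem (pow_pos (Fact.out : p.Prime).pos n) (hE x (hB.1 hx))) h1.ge

theorem rBaseCard_le_irrDegree (F E : Subfield Ω) (n : ℕ) :
    rBaseCard p F (rootField p (n + 1) F ⊓ E) ≤ irrDegree p F E :=
  le_ciSup (f := fun n : ℕ => rBaseCard p F (rootField p (n + 1) F ⊓ E)) (Cardinal.bddAbove_of_small) n

theorem le_rootField (n : ℕ) : k ≤ rootField p n k := fun _ hx =>
  (mem_rootField p).2 (pow_mem hx _)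

/-- The first layer has a finite `r`-base and bounded exponent. -/
theorem isFiniteExt_of_irrDegree_le {S : Subfield Ω} (hkS : k ≤ S) {j : ℕ}
    (hj : irrDegree p k S ≤ j) : IsFiniteExt k (rootField p 1 k ⊓ S) := by
  obtain ⟨B, hB, hBc⟩ := exists_isRBase_card_eq p (le_inf (le_rootField (p := p) 1) hkS)
  refine isFiniteExt_of_isRBase hB (fun x hx => (mem_rootField p).1 hx.1) ?_
  rw [← Cardinal.lt_aleph0_iff_set_finite, hBc]
  exact ((rBaseCard_le_irrDegree k S 0).trans hj).trans_lt (Cardinal.natCast_lt_aleph0)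

/-- All layers of `k/k^p` equal `k`, so the hypothesis says that an `r`-base of `k/k^p` is infinite;
`Option ℕ` embeds in it. -/
theorem exists_isPFree (hk : Cardinal.aleph0 ≤ imperfectionDegree p k) :
    ∃ (X : ℕ → Ω) (t : Ω), IsPFree p k (fun o : Option ℕ => o.elim t X) := by
  have hroot : ∀ n, rootField p (n + 1) (powField p 1 k) ⊓ k = k := fun n =>
    inf_eq_right.2 fun x hx => (mem_rootField p).2
      (powField_le_one p n k ((mem_powField p).2 ⟨x, hx, rfl⟩))
  rw [imperfectionDegree, irrDegree] at hk
  simp only [hroot, ciSup_const] at hk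
  obtain ⟨B, hB, hBc⟩ := exists_isRBase_card_eq p (powField_le p 1 k)
  rw [← hBc, Cardinal.aleph0_le_mk_iff] at hk
  let f : Option ℕ ↪ B := (Denumerable.eqv (Option ℕ)).toEmbedding.trans (Infinite.natEmbedding B)
  refine ⟨fun i => f (some i), f none, ?_⟩
  have hf : (fun o : Option ℕ => o.elim (f none : Ω) fun i => (f (some i) : Ω)) =
      fun o => (f o : Ω) := by
    ext o
    cases o <;> rfl
  rw [hf]
  refine ⟨fun o => hB.1 (f o).2, fun o ho => hB.2.2 _ (f o).2 (adj_mono le_rfl ?_ ho)⟩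
  rintro _ ⟨o', ho', rfl⟩
  refine Or.inr ⟨(f o').2, fun h => ho' (f.injective (Subtype.ext h))⟩

theorem exists_enumeration [IsAlgClosed Ω] [Countable Ω] {X : ℕ → Ω}
    (hX : PIndep p (powField p 1 k) X) (hXk : ∀ i, X i ∈ k) :
    ∃ L : ℕ → Subfield Ω, L '' Set.Ici 3 = properFiniteSubexts p k X := by
  have hcount : (properFiniteSubexts p k X).Countable := by
    refine (Set.countable_range fun T : Finset Ω => adj k (T : Set Ω)).mono ?_
    rintro L ⟨-, -, hL⟩
    obtain ⟨T, hT⟩ := hL.exists_finset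
    exact ⟨T, hT.symm⟩
  -- A sequence can enumerate only a nonempty set; a `p`-th root of `X 0` generates a member.
  have hne : (properFiniteSubexts p k X).Nonempty := by
    obtain ⟨y, hy⟩ := exists_pow_eq p 1 (X 0)
    have hfin : IsFiniteExt k (adj k {y}) := by
      refine isFiniteExt_of_le_adj (le_adj _ _) (Set.finite_singleton y) ?_ le_rfl
      rintro _ rfl
      exact isAlgebraic_of_pow_mem (pow_pos (Fact.out : p.Prime).pos 1) (hy ▸ hXk 0)
    refine ⟨adj k {y}, lt_of_le_of_ne (le_adj _ _) ?_, lt_of_le_of_ne ?_ ?_, hfin⟩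
    · intro h
      have hyk : y ∈ k := h ▸ subset_adj _ _ rfl
      exact (hX 0).2 (le_adj _ _ ((mem_powField p).2 ⟨y, hyk, hy⟩))
    · rw [adjRoots]
      exact adj_mono le_rfl (by rintro _ rfl; exact ⟨0, hy⟩)
    · intro h
      rw [adjRoots_eq_rootExt] at h
      exact hX.not_isFiniteExt_rootExt (h ▸ hfin)
  obtain ⟨f, hf⟩ := hcount.exists_eq_range hne
  refine ⟨fun n => f (n - 3), ?_⟩
  rw [hf]
  ext L
  constructor
  · rintro ⟨n, -, rfl⟩
    exact ⟨_, rfl⟩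
  · rintro ⟨n, rfl⟩
    exact ⟨n + 3, by simp, by simp⟩

variable {X : ℕ → Ω} {L M : ℕ → Subfield Ω}

theorem IsTower.le_of_le (h : IsTower p k X L M) {m n : ℕ} (hm : 1 ≤ m) (hmn : m ≤ n) : M m ≤ M n := by
  induction n, hmn using Nat.le_induction with
  | base => exact le_rfl
  | succ n hmn ih => exact ih.trans (h.mono n (hm.trans hmn))

theorem IsTower.base_le (h : IsTower p k X L M) {n : ℕ} (hn : 1 ≤ n) : k ≤ M n :=
  (h.one ▸ le_adj _ _ : k ≤ M 1).trans (h.le_of_le le_rfl hn)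

theorem IsTower.pow_mem_base (h : IsTower p k X L M) {n : ℕ} (hn : 1 ≤ n) {x : Ω} (hx : x ∈ M n) :
    x ^ p ^ n ∈ k := by
  rw [← h.inf_succ n hn] at hx
  exact (mem_rootField p).1 hx.1

theorem IsTower.mem_of_pow_mem (h : IsTower p k X L M) {m n : ℕ} (hn : 1 ≤ n) {x : Ω} (hm : 1 ≤ m)
    (hx : x ∈ M m) (hxn : x ^ p ^ n ∈ k) : x ∈ M n := by
  rcases le_total m n with hmn | hmn
  · exact h.le_of_le hm hmn hx
  · clear hm
    induction m, hmn using Nat.le_induction with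
    | base => exact hx
    | succ m hmn ih =>
      refine ih ?_
      rw [← h.inf_succ m (hn.trans hmn)]
      exact ⟨(mem_rootField p).2 (pow_mem_of_le p hmn hxn), hx⟩

variable {K : Subfield Ω}

theorem IsTower.isPurelyInsep (h : IsTower p k X L M) (hK : ∀ x, x ∈ K ↔ ∃ n, 1 ≤ n ∧ x ∈ M n) :
    IsPurelyInsep k K := by
  refine (isPurelyInsep_iff p).2 ⟨fun x hx => (hK x).2 ⟨1, le_rfl, h.base_le le_rfl hx⟩, fun x hx => ?_⟩
  obtain ⟨n, hn, hxn⟩ := (hK x).1 hx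
  exact ⟨n, h.pow_mem_base hn hxn⟩

theorem powField_mono {n : ℕ} {E F : Subfield Ω} (h : E ≤ F) : powField p n E ≤ powField p n F := by
  intro x hx
  obtain ⟨y, hy, rfl⟩ := (mem_powField p).1 hx
  exact (mem_powField p).2 ⟨y, h hy, rfl⟩

theorem IsTower.isModular (h : IsTower p k X L M) (hK : ∀ x, x ∈ K ↔ ∃ n, 1 ≤ n ∧ x ∈ M n) :
    IsModular p k K := by
  refine ⟨h.isPurelyInsep hK, fun r => linDisj_iff.2 fun m x hx hli => ?_⟩
  have hex : ∀ i, ∃ n, 1 ≤ n ∧ x i ∈ powField p r (M n) := by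
    intro i
    obtain ⟨y, hy, hyx⟩ := (mem_powField p).1 (hx i)
    obtain ⟨n, hn, hyn⟩ := (hK y).1 hy
    exact ⟨n, hn, (mem_powField p).2 ⟨y, hyn, hyx⟩⟩
  choose n hn hxn using hex
  set N := Finset.univ.sup n + 3 with hN
  have hle : M N ≤ K := fun y hy => (hK y).2 ⟨N, by omega, hy⟩
  refine linDisj_iff.1 ((h.equi N (by omega)).isModular.2 r) m x (fun i => ?_)
    (linearIndependent_of_le (inf_le_inf_right _ (powField_mono hle)) hli)
  have : n i ≤ Finset.univ.sup n := Finset.le_sup (Finset.mem_univ i)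
  exact powField_mono (h.le_of_le (hn i) (by omega)) (hxn i)

theorem IsTower.rootField_inf_eq (h : IsTower p k X L M)
    (hK : ∀ x, x ∈ K ↔ ∃ n, 1 ≤ n ∧ x ∈ M n) {n : ℕ} (hn : 1 ≤ n) : rootField p n k ⊓ K = M n := by
  ext x
  constructor
  · rintro ⟨hxn, hxK⟩
    obtain ⟨m, hm, hxm⟩ := (hK x).1 hxK
    exact h.mem_of_pow_mem hn hm hxm ((mem_rootField p).1 hxn)
  · exact fun hx => ⟨(mem_rootField p).2 (h.pow_mem_base hn hx), (hK x).2 ⟨n, hn, hx⟩⟩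

theorem IsTower.aleph0_le_irrDegree [IsAlgClosed Ω] (hX : PIndep p (powField p 1 k) X)
    (h : IsTower p k X L M) (hK : ∀ x, x ∈ K ↔ ∃ n, 1 ≤ n ∧ x ∈ M n) :
    Cardinal.aleph0 ≤ irrDegree p k K := by
  by_contra hlt
  obtain ⟨j, hj⟩ := Cardinal.lt_aleph0.1 (not_le.1 hlt)
  have h1 := isFiniteExt_of_irrDegree_le (h.isPurelyInsep hK).1 hj.le
  rw [h.rootField_inf_eq hK le_rfl, h.one, adjRoots_eq_rootExt] at h1
  exact hX.not_isFiniteExt_rootExt h1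

/-- If `V` is generated over `k` by elements of `M n ^ {p ^ r}` for all `r < n` then `M n / V` is modular. -/
theorem IsTower.isModular_of_le_adj (h : IsTower p k X L M) {n : ℕ} (hn : 3 ≤ n) {V : Subfield Ω}
    (hkV : k ≤ V) (hVM : V ≤ M n)
    (hV : ∀ r < n, V ≤ adj k ((powField p r (M n) ⊓ V : Subfield Ω) : Set Ω)) :
    IsModular p V (M n) := by
  refine isModular_of_pow_mem_or_linDisj hVM (fun x hx => hkV (h.pow_mem_base (by omega) hx))
    fun r hr => ?_
  refine ((h.equi n hn).isModular.2 r).of_adj hkV (hV r hr) fun x hx => ?_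
  exact isAlgebraic_of_pow_mem (pow_pos (Fact.out : p.Prime).pos n)
    (h.pow_mem_base (by omega) (powField_le p r _ hx))

theorem IsTower.isInftyW0Generated [IsAlgClosed Ω] (hX : PIndep p (powField p 1 k) X)
    (hL : L '' Set.Ici 3 = properFiniteSubexts p k X)
    (h : IsTower p k X L M) (hK : ∀ x, x ∈ K ↔ ∃ n, 1 ≤ n ∧ x ∈ M n) : IsInftyW0Generated p k K := by
  refine fun j _ => ⟨h.isPurelyInsep hK, ?_⟩
  rintro ⟨S, hkS, hSK, hunb, hdi⟩
  have hfin := isFiniteExt_of_irrDegree_le hkS hdi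
  set V : ℕ → Subfield Ω := fun n =>
    adj k (powField p n (rootField p (n + 1) k ⊓ S) : Set Ω) with hV
  have hkV : ∀ n, k ≤ V n := fun n => le_adj _ _
  have hVS : ∀ n, V n ≤ rootField p 1 k ⊓ S := by
    intro n
    refine adj_le (le_inf (le_rootField 1) hkS) ?_
    intro x hx
    obtain ⟨y, hy, rfl⟩ := (mem_powField p).1 hx
    refine ⟨(mem_rootField p).2 ?_, pow_mem hy.2 _⟩
    rw [← pow_mul, ← pow_add]
    exact (mem_rootField p).1 hy.1
  have hanti : Antitone V := by
    refine antitone_nat_of_succ_le fun n => adj_mono le_rfl fun x hx => ?_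
    obtain ⟨y, hy, rfl⟩ := (mem_powField p).1 hx
    refine (mem_powField p).2 ⟨y ^ p, ⟨(mem_rootField p).2 ?_, pow_mem hy.2 _⟩, ?_⟩
    · rw [← pow_mul, ← pow_succ']
      exact (mem_rootField p).1 hy.1
    · rw [← pow_mul, ← pow_succ']
  obtain ⟨N, hN⟩ := hfin.exists_stationary hkV hVS hanti
  have hS1 : rootField p 1 k ⊓ S ≤ M 1 := by
    rw [← h.rootField_inf_eq hK le_rfl]
    exact inf_le_inf_left _ hSK.le
  have hVfin : IsFiniteExt k (V N) := hfin.of_le (hkV N) (hVS N)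
  have hVmem : V N ∈ properFiniteSubexts p k X := by
    refine ⟨lt_of_le_of_ne (hkV N) ?_, lt_of_le_of_ne (h.one ▸ (hVS N).trans hS1) ?_, hVfin⟩
    · intro heq
      refine hunb ⟨N, fun x hx => ?_⟩
      by_contra hxN
      have hex := ((isPurelyInsep_iff p).1 (h.isPurelyInsep hK)).2 x (hSK.le hx)
      classical
      set m := Nat.find hex with hm
      have hxm : x ^ p ^ m ∈ k := Nat.find_spec hex
      have hmN : N < m := by
        by_contra hle
        exact hxN (pow_mem_of_le p (not_lt.1 hle) hxm)
      obtain ⟨d, hd⟩ := Nat.exists_eq_add_of_lt hmN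
      refine Nat.find_min hex (m := N + d) (by omega) ?_
      rw [heq]
      -- Here `m = N + d + 1` is the exponent of `x`, so `x ^ p ^ d` has exponent `N + 1`; its
      -- `p^N`-th power lies in `V N = k`, contradicting minimality of `m`.
      refine subset_adj _ _ ((mem_powField p).2 ⟨x ^ p ^ d, ⟨(mem_rootField p).2 ?_, pow_mem hx _⟩, ?_⟩)
      · rw [← pow_mul, ← pow_add]
        convert hxm using 3
        omega
      · rw [← pow_mul, ← pow_add, add_comm]
    · intro heq
      rw [heq, adjRoots_eq_rootExt] at hVfin
      exact hX.not_isFiniteExt_rootExt hVfin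
  rw [← hL] at hVmem
  obtain ⟨n, hn, hLn⟩ := hVmem
  have hn3 : 3 ≤ n := hn
  refine h.not_modular n hn3 ?_
  rw [hLn]
  refine h.isModular_of_le_adj hn3 (hkV N) (((hVS N).trans hS1).trans (h.le_of_le le_rfl (by omega)))
    fun r hr => ?_
  -- Generators of `V (N + n)` are powers `z^{p^{N+n}}`, hence `p^r`-th powers of `z^{p^{N+n-r}}`.
  -- That element has exponent at most `r + 1 ≤ n` and so lies in `M n`.
  have hVm : V N = V (N + n) := (hN _ (by omega)).symm
  conv_lhs => rw [hVm]
  refine adj_le (le_adj _ _) fun x hx => subset_adj _ _ ⟨?_, ?_⟩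
  · obtain ⟨z, hz, rfl⟩ := (mem_powField p).1 hx
    refine (mem_powField p).2 ⟨z ^ p ^ (N + n - r), ?_, ?_⟩
    · rw [← h.rootField_inf_eq hK (by omega : 1 ≤ n)]
      refine ⟨(mem_rootField p).2 ?_, pow_mem (hSK.le hz.2) _⟩
      rw [← pow_mul, ← pow_add]
      exact pow_mem_of_le p (by omega) ((mem_rootField p).1 hz.1)
    · rw [← pow_mul, ← pow_add]
      congr 2
      omega
  · rw [hVm]
    exact subset_adj _ _ hx

end Tower

end PurelyInsep

end

theorem mainTheorem3 {Ω : Type*} [Field Ω] (p : ℕ) [Fact p.Prime] [CharP Ω p]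
    (k : Subfield Ω) [IsAlgClosure k Ω] [Countable k]
    (hk : Cardinal.aleph0 ≤ PurelyInsep.imperfectionDegree p k) :
    -- there are infinite `p`-free families `((X i), t)` in `k`
    (∃ (X : ℕ → Ω) (t : Ω), PurelyInsep.IsPFree p k (fun o : Option ℕ => o.elim t X)) ∧
    ∀ (X : ℕ → Ω) (t : Ω), PurelyInsep.IsPFree p k (fun o : Option ℕ => o.elim t X) →
      -- the finite proper subextensions of `M 1` can be enumerated as `(L n)`, `n ≥ 3`
      (∃ L : ℕ → Subfield Ω, L '' Set.Ici 3 = PurelyInsep.properFiniteSubexts p k X) ∧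
      ∀ L : ℕ → Subfield Ω, L '' Set.Ici 3 = PurelyInsep.properFiniteSubexts p k X →
        -- the construction can be carried out
        (∃ M : ℕ → Subfield Ω, PurelyInsep.IsTower p k X L M) ∧
        -- and its outcome always has the required properties
        ∀ M : ℕ → Subfield Ω, PurelyInsep.IsTower p k X L M →
          ∃ K : Subfield Ω, ((K : Set Ω) = ⋃ n ∈ Set.Ici 1, (M n : Set Ω)) ∧
            PurelyInsep.IsModular p k K ∧
            PurelyInsep.IsInftyW0Generated p k K ∧
            Cardinal.aleph0 ≤ PurelyInsep.irrDegree p k K := by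
  have : IsAlgClosed Ω := IsAlgClosure.isAlgClosed k
  have : Algebra.IsAlgebraic k Ω := IsAlgClosure.isAlgebraic
  have : Countable Ω := by
    rw [← Cardinal.mk_le_aleph0_iff]
    exact (Algebra.IsAlgebraic.cardinalMk_le_max k Ω).trans
      (max_le (Cardinal.mk_le_aleph0_iff.2 ‹_›) le_rfl)
  refine ⟨PurelyInsep.exists_isPFree hk, fun X t hXt => ?_⟩
  have hfam := hXt.pIndep
  have hX : PurelyInsep.PIndep p (PurelyInsep.powField p 1 k) X :=
    hfam.comp (Option.some_injective ℕ)
  have hXk : ∀ i, X i ∈ k := fun i => hXt.1 (some i)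
  have ht : t ∈ k := hXt.1 none
  have htX : t ∉ PurelyInsep.adj (PurelyInsep.powField p 1 k) (Set.range X) := by
    have h1 := hfam.notMem (i := none) (J := Set.range some) (by simp)
    rwa [← Set.range_comp] at h1
  refine ⟨PurelyInsep.exists_enumeration hX hXk, fun L hL => ⟨?_, fun M hM => ?_⟩⟩
  · exact PurelyInsep.exists_isTower ht hX hXk htX fun n hn => hL ▸ ⟨n, hn, rfl⟩
  -- The index is shifted because `M 0` is arbitrary.
  · have hdir : Directed (· ≤ ·) fun n => M (n + 1) :=
      (monotone_nat_of_le_succ fun n => hM.mono (n + 1) (by omega)).directed_le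
    have hK : ∀ x, x ∈ (⨆ n, M (n + 1)) ↔ ∃ n, 1 ≤ n ∧ x ∈ M n := by
      intro x
      rw [Subfield.mem_iSup_of_directed hdir]
      constructor
      · rintro ⟨n, hn⟩
        exact ⟨n + 1, by omega, hn⟩
      · rintro ⟨n, hn, hx⟩
        obtain ⟨m, rfl⟩ := Nat.exists_eq_add_of_le' hn
        exact ⟨m, hx⟩
    refine ⟨⨆ n, M (n + 1), ?_, hM.isModular hK, hM.isInftyW0Generated hX hL hK,
      hM.aleph0_le_irrDegree hX hK⟩
    ext x
    rw [SetLike.mem_coe, hK x]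
    simp
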